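/- Fix $T>0$, integers $l,d$, and real numbers $\gamma>1/4$ and $0<\kappa<\gamma$ with $3\kappa+\gamma>1$. Sums over repeated indices are implied. **Increments.** For $g:[0,T]\to V$ put $(\delta g)_{st}=g_t-g_s$, and for $h:[0,T]^2\to V$ put $(\delta h)_{sut}=h_{st}-h_{su}-h_{ut}$. For $\mu>0$ let $\mathcal C_2^\mu(V)$ be the set of $f:[0,T]^2\to V$ with $f_{ss}=0$ and $\|f\|_\mu=\sup_{s,t}|f_{st}|/|t-s|^\mu<\infty$, let $\mathcal C_1^\mu(V)$ be the set of continuous $g:[0,T]\to V$ with $\|g\|_\mu:=\|\delta g\|_\mu<\infty$, and $\mathcal C_2^{1+}=\bigcup_{\mu>1}\mathcal C_2^\mu$. For $h:[0,T]^3\to V$, $\Lambda(h)$ denotes the element $g\in\mathcal C_2^{1+}(V)$ with $\delta g=h$, when it exists (it is then unique). A product $fg$ of increments means $(fg)_{st}=f_sg_{st}$ if $f$ is a path and $g$ is a function of two times, and $(fg)_{sut}=f_{su}g_{ut}$ if both are functions of two times. **Driver.** A driver is $X=(x,\mathbf x^2,\mathbf x^3)$ with $x\in\mathcal C_1^\gamma(\mathbb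 R^d)$, $\mathbf x^2\in\mathcal C_2^{2\gamma}(\mathbb R^{d,d})$, $\mathbf x^3\in\mathcal C_2^{3\gamma}(\mathbb R^{d,d,d})$ such that, for all $s,u,t\in[0,T]$ and all $i,j,k$, Chen's relations $$(\delta\mathbf x^{2})^{ij}_{sut}=(\delta x^i)_{su}(\delta x^j)_{ut},\qquad (\delta\mathbf x^{3})^{ijk}_{sut}=(\mathbf x^2_{su})^{ij}(\delta x^k)_{ut}+(\delta x^i)_{su}(\mathbf x^2_{ut})^{jk}$$ hold, and such that $\tfrac12\big((\mathbf x^2_{st})^{ij}+(\mathbf x^2_{st})^{ji}\big)=\tfrac12(\delta x^i)_{st}(\delta x^j)_{st}$ for $s<t$. Put $|X|_\gamma=\|x\|_\gamma+\|\mathbf x^2\|_{2\gamma}+\|\mathbf x^3\|_{3\gamma}$. **Weakly controlled paths.** A weakly controlled path in $\mathbb R^n$ based on $X$ is a triple $(z,\zeta^1,\zeta^2)$ with $z\in\mathcal C_1^\kappa(\mathbb R^n)$, $\zeta^1\in\mathcal C_1^\kappa(\mathbb R^{n,d})$, $\zeta^2\in\mathcal C_1^\kappa(\mathbb R^{n,d,d})$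 and $$\delta z^i=(\zeta^1)^{ij}\delta x^j+(\zeta^2)^{ijk}(\mathbf x^2)^{kj}+r^i,\qquad \delta(\zeta^1)^{ij}=(\zeta^2)^{ijk}\delta x^k+\rho^{ij},\qquad r\in\mathcal C_2^{3\kappa},\ \rho\in\mathcal C_2^{2\kappa}.$$ It belongs to $\mathcal Q_{\kappa,a,b}(\mathbb R^n)$ if moreover $z_0=a$ and $\zeta^1_0=b$. If $\varphi$ is a $C^2$ function of $z$, then $\varphi(z)$ is equipped with $(\hat\zeta^1)^{j}=\partial_p\varphi(z)(\zeta^1)^{pj}$ and $(\hat\zeta^2)^{jk}=\partial_p\varphi(z)(\zeta^2)^{pjk}+\partial_{pq}\varphi(z)(\zeta^1)^{pj}(\zeta^1)^{qk}$ (for vector-valued $\varphi$, component by component). If $(m,\mu^1,\mu^2)$ is a weakly controlled path in $\mathbb R^{l,d}$ with remainders $r,\rho$, set $$\mathcal J(m\,dx)^i=m^{ij}\delta x^j+(\mu^1)^{ijk}(\mathbf x^2)^{kj}+(\mu^2)^{ijk_1k_2}(\mathbf x^3)^{k_2k_1j}+\Lambda\big(r^{ij}\delta x^j+\rho^{ijk}(\mathbf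 x^2)^{kj}+\delta(\mu^2)^{ijk_1k_2}(\mathbf x^3)^{k_2k_1j}\big);$$ a path $z$ with $\delta z=\mathcal J(m\,dx)$ is regarded as the controlled path $(z,m,\mu^1)$. **Equation.** Let $\sigma:\mathbb R^l\to\mathbb R^{l,d}$ be of class $C^4_b$ (that is, $C^4$, bounded together with its derivatives up to order $4$). A solution of $dy=\sigma(y)\,dx$, $y_0=a$, is an element $(y,\zeta^1,\zeta^2)$ of $\mathcal Q_{\kappa,a,\sigma(a)}(\mathbb R^l)$ such that $\sigma(y)$ is a weakly controlled path and, as controlled paths, $y$ is the integral of $\sigma(y)$: $\delta y=\mathcal J(\sigma(y)\,dx)$ (the term $\Lambda$ in it being defined), $\zeta^1=\sigma(y)$, and $\zeta^2$ is the first derivative component $\hat\zeta^1$ of $\sigma(y)$, i.e. $(\zeta^2)^{ijk}=\partial_p\sigma^{ij}(y)(\zeta^1)^{pk}$. **Theorem.** (i) For every driver $X$ and every $a\in\mathbb R^l$ the equation $dy=\sigma(y)\,dx$, $y_0=a$, has exactly one solution in $\mathcal Q_{\kappa,a,\sigma(a)}(\mathbb R^l)$. (ii) The map $(a,x,\mathbf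 x^2,\mathbf x^3)\mapsto y$ with values in $\mathcal C_1^\kappa(\mathbb R^l)$ is Lipschitz continuous, uniformly in $a$ and locally uniformly in the driver: for every $M\ge0$ there is a constant $c>0$ (depending only on $M,\sigma,\gamma,\kappa,T,l,d$) such that for all drivers $X,\tilde X$ with $|X|_\gamma\le M$, $|\tilde X|_\gamma\le M$, all $a,\tilde a\in\mathbb R^l$, and the solutions $y,\tilde y$ of the corresponding equations, $$\|y-\tilde y\|_\kappa\le c\,\big\{|a-\tilde a|+\|x-\tilde x\|_\gamma+\|\mathbf x^2-\tilde{\mathbf x}^2\|_{2\gamma}+\|\mathbf x^3-\tilde{\mathbf x}^3\|_{3\gamma}\big\}.$$ -/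

import Mathlib

open scoped NNReal ENNReal

namespace RoughDiff

/-- `ℝ^ι` with the Euclidean norm; arrays such as `ℝ^{l,d}` are `Vec (Fin l × Fin d)`. -/
abbrev Vec (ι : Type) [Fintype ι] : Type := EuclideanSpace ℝ ι

/-- The time interval `[0,T]`. -/
abbrev Time (T : ℝ) : Type := Set.Icc (0 : ℝ) T

section Increments

variable {T : ℝ} {V : Type} [NormedAddCommGroup V]

/-- `(δ g)_{st} = g_t - g_s`. -/
def delta1 (g : Time T → V) (s t : Time T) : V := g t - g s

/-- `(δ h)_{sut} = h_{st} - h_{su} - h_{ut}`. -/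
def delta2 (h : Time T → Time T → V) (s u t : Time T) : V := h s t - h s u - h u t

/-- `‖f‖_μ = sup_{s,t} |f_{st}| / |t - s|^μ`, with values in `[0,∞]` (here `0 / 0 = 0`, and
`c / 0 = ∞` for `c ≠ 0`). -/
noncomputable def norm2 (μ : ℝ) (f : Time T → Time T → V) : ℝ≥0∞ :=
  ⨆ (s : Time T) (t : Time T), ‖f s t‖ₑ / ENNReal.ofReal (|(t : ℝ) - (s : ℝ)| ^ μ)

/-- The Hölder seminorm of a path: `‖g‖_μ = ‖δ g‖_μ`. -/
noncomputable def norm1 (μ : ℝ) (g : Time T → V) : ℝ≥0∞ := norm2 μ (delta1 g)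

/-- `f ∈ C_2^μ(V)`. -/
def MemC2 (μ : ℝ) (f : Time T → Time T → V) : Prop := (∀ s, f s s = 0) ∧ norm2 μ f < ∞

/-- `g ∈ C_1^μ(V)`. -/
def MemC1 (μ : ℝ) (g : Time T → V) : Prop := Continuous g ∧ norm1 μ g < ∞

/-- `f ∈ C_2^{1+}(V) = ⋃_{μ > 1} C_2^μ(V)`. -/
def MemC2OnePlus (f : Time T → Time T → V) : Prop := ∃ μ : ℝ, 1 < μ ∧ MemC2 μ f

/-- `g = Λ(h)`: `g` is the element of `C_2^{1+}(V)` with `δ g = h`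
(there is at most one, see `IsLambda.unique`). -/
def IsLambda (h : Time T → Time T → Time T → V) (g : Time T → Time T → V) : Prop :=
  MemC2OnePlus g ∧ delta2 g = h

theorem MemC2.bound {μ : ℝ} {f : Time T → Time T → V} (hf : MemC2 μ f) :
    ∃ C : ℝ, ∀ s t, ‖f s t‖ ≤ C * |(t : ℝ) - (s : ℝ)| ^ μ := by
  refine ⟨(norm2 μ f).toReal, fun s t => ?_⟩
  by_cases hst : s = t
  · subst hst
    rw [hf.1, norm_zero]
    exact mul_nonneg ENNReal.toReal_nonneg (Real.rpow_nonneg (abs_nonneg _) _)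
  · have hpos : 0 < |(t : ℝ) - (s : ℝ)| ^ μ :=
      Real.rpow_pos_of_pos (abs_pos.2 fun h => hst (Subtype.ext (sub_eq_zero.1 h).symm)) _
    have h1 : ‖f s t‖ₑ / ENNReal.ofReal (|(t : ℝ) - (s : ℝ)| ^ μ) ≤ norm2 μ f :=
      le_iSup₂ (f := fun s t : Time T =>
        ‖f s t‖ₑ / ENNReal.ofReal (|(t : ℝ) - (s : ℝ)| ^ μ)) s t
    rw [ENNReal.div_le_iff (by simpa using hpos) ENNReal.ofReal_ne_top] at h1
    have h2 := ENNReal.toReal_mono (ENNReal.mul_ne_top hf.2.ne ENNReal.ofReal_ne_top) h1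
    rwa [toReal_enorm, ENNReal.toReal_mul, ENNReal.toReal_ofReal hpos.le] at h2

/-- `Λ` is single-valued. -/
theorem IsLambda.unique {h : Time T → Time T → Time T → V} {g g' : Time T → Time T → V}
    (hg : IsLambda h g) (hg' : IsLambda h g') : g = g' := by
  obtain ⟨⟨μ, hμ, hm⟩, he⟩ := hg
  obtain ⟨⟨ν, hν, hn⟩, he'⟩ := hg'
  obtain ⟨C, hC⟩ := hm.bound
  obtain ⟨D, hD⟩ := hn.bound
  have key : ∀ (n : ℕ) (s t : Time T), ‖g s t - g' s t‖ ≤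
      2 ^ n * (C * (|(t : ℝ) - s| / 2 ^ n) ^ μ + D * (|(t : ℝ) - s| / 2 ^ n) ^ ν) := by
    intro n
    induction n with
    | zero =>
      intro s t
      simpa using (norm_sub_le _ _).trans (add_le_add (hC s t) (hD s t))
    | succ n ih =>
      intro s t
      have hs := s.2
      have ht := t.2
      let u : Time T := ⟨((s : ℝ) + t) / 2, by
        constructor <;> linarith [hs.1, hs.2, ht.1, ht.2]⟩
      have h1 : |(u : ℝ) - s| = |(t : ℝ) - s| / 2 := by
        have : (u : ℝ) - s = ((t : ℝ) - s) / 2 := by simp only [u]; ring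
        rw [this, abs_div, abs_two]
      have h2 : |(t : ℝ) - u| = |(t : ℝ) - s| / 2 := by
        have : (t : ℝ) - u = ((t : ℝ) - s) / 2 := by simp only [u]; ring
        rw [this, abs_div, abs_two]
      have e := congrFun (congrFun (congrFun (he.trans he'.symm) s) u) t
      have e' : g s t - g' s t = (g s u - g' s u) + (g u t - g' u t) := by
        simp only [delta2] at e
        rw [← sub_eq_zero] at e ⊢
        rw [← e]
        abel
      have i1 := ih s u
      have i2 := ih u t
      rw [h1] at i1
      rw [h2] at i2
      have h3 : |(t : ℝ) - s| / 2 / 2 ^ n = |(t : ℝ) - s| / 2 ^ (n + 1) := by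
        rw [div_div, pow_succ']
      rw [h3] at i1 i2
      rw [e']
      calc _ ≤ _ := norm_add_le _ _
        _ ≤ _ := add_le_add i1 i2
        _ = _ := by rw [pow_succ]; ring
  have lim : ∀ (E x p : ℝ), 0 ≤ x → 1 < p →
      Filter.Tendsto (fun n : ℕ => (2 : ℝ) ^ n * (E * (x / 2 ^ n) ^ p)) Filter.atTop
        (nhds 0) := by
    intro E x p hx hp
    have hq : (2 : ℝ) ^ (1 - p) < 1 :=
      Real.rpow_lt_one_of_one_lt_of_neg one_lt_two (by linarith)
    have h0 := (tendsto_pow_atTop_nhds_zero_of_lt_one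
      (Real.rpow_nonneg zero_le_two (1 - p)) hq).const_mul (E * x ^ p)
    rw [mul_zero] at h0
    refine h0.congr fun n => ?_
    rw [Real.div_rpow hx (by positivity), ← Real.rpow_natCast, ← Real.rpow_mul zero_le_two,
      ← Real.rpow_natCast (2 : ℝ) n, ← Real.rpow_mul zero_le_two]
    have : (2 : ℝ) ^ ((1 - p) * n) = 2 ^ (n : ℝ) / 2 ^ ((n : ℝ) * p) := by
      rw [← Real.rpow_sub zero_lt_two]
      ring_nf
    rw [this]
    ring
  funext s t
  have l := (lim C |(t : ℝ) - s| μ (abs_nonneg _) hμ).add (lim D |(t : ℝ) - s| ν (abs_nonneg _) hν)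
  rw [add_zero] at l
  have := ge_of_tendsto' l fun n => (key n s t).trans (by rw [mul_add])
  exact sub_eq_zero.1 (norm_le_zero_iff.1 this)

end Increments

/-- A path `x` in `ℝ^d` with an area `x2` and a volume `x3`. -/
structure Driver (T : ℝ) (d : ℕ) where
  x : Time T → Vec (Fin d)
  x2 : Time T → Time T → Vec (Fin d × Fin d)
  x3 : Time T → Time T → Vec (Fin d × Fin d × Fin d)

/-- Regularity `(γ, 2γ, 3γ)` and Chen's relations. -/
structure Driver.IsRough {T : ℝ} {d : ℕ} (X : Driver T d) (γ : ℝ) : Prop where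
  mem_x : MemC1 γ X.x
  mem_x2 : MemC2 (2 * γ) X.x2
  mem_x3 : MemC2 (3 * γ) X.x3
  chen2 : ∀ (s u t : Time T) (i j : Fin d),
    delta2 X.x2 s u t (i, j) = delta1 X.x s u i * delta1 X.x u t j
  chen3 : ∀ (s u t : Time T) (i j k : Fin d),
    delta2 X.x3 s u t (i, j, k) =
      X.x2 s u (i, j) * delta1 X.x u t k + delta1 X.x s u i * X.x2 u t (j, k)

/-- The symmetric part of the area is half of the tensor square of the increment of the path. -/
def Driver.IsGeometric {T : ℝ} {d : ℕ} (X : Driver T d) : Prop :=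
  ∀ s t : Time T, s < t → ∀ i j : Fin d,
    (1 / 2 : ℝ) * (X.x2 s t (i, j) + X.x2 s t (j, i)) =
      (1 / 2 : ℝ) * (delta1 X.x s t i * delta1 X.x s t j)

/-- The data `(z, ζ¹, ζ²)` of a weakly controlled path in `ℝ^ι`, the driver having values
in `ℝ^d`. -/
@[ext] structure Triple (T : ℝ) (d : ℕ) (ι : Type) [Fintype ι] where
  z : Time T → Vec ι
  ζ1 : Time T → Vec (ι × Fin d)
  ζ2 : Time T → Vec (ι × Fin d × Fin d)

section Controlled

variable {T : ℝ} {d : ℕ} {ι : Type} [Fintype ι]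

/-- `r^i_{st} = (δz^i)_{st} - (ζ¹_s)^{ij} (δx^j)_{st} - (ζ²_s)^{ijk} (x²_{st})^{kj}`. -/
noncomputable def Triple.r (Z : Triple T d ι) (X : Driver T d) (s t : Time T) : Vec ι :=
  WithLp.toLp 2 fun i =>
    delta1 Z.z s t i - ∑ j, Z.ζ1 s (i, j) * delta1 X.x s t j
      - ∑ j, ∑ k, Z.ζ2 s (i, j, k) * X.x2 s t (k, j)

/-- `ρ^{ij}_{st} = (δ(ζ¹)^{ij})_{st} - (ζ²_s)^{ijk} (δx^k)_{st}`. -/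
noncomputable def Triple.ρ (Z : Triple T d ι) (X : Driver T d) (s t : Time T) :
    Vec (ι × Fin d) :=
  WithLp.toLp 2 fun p =>
    delta1 Z.ζ1 s t p - ∑ k, Z.ζ2 s (p.1, p.2, k) * delta1 X.x s t k

/-- `(z, ζ¹, ζ²)` is a `κ`-weakly controlled path based on `X`. -/
structure Triple.IsControlled (Z : Triple T d ι) (X : Driver T d) (κ : ℝ) : Prop where
  mem_z : MemC1 κ Z.z
  mem_ζ1 : MemC1 κ Z.ζ1
  mem_ζ2 : MemC1 κ Z.ζ2
  mem_r : MemC2 (3 * κ) (Z.r X)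
  mem_ρ : MemC2 (2 * κ) (Z.ρ X)

/-- Membership in `Q_{κ,a,b}(ℝ^ι)`: controlled, with `z_0 = a` and `ζ¹_0 = b`. -/
def Triple.MemQ (Z : Triple T d ι) (X : Driver T d) (κ : ℝ) (a : Vec ι)
    (b : Vec (ι × Fin d)) : Prop :=
  Z.IsControlled X κ ∧ ∀ t : Time T, (t : ℝ) = 0 → Z.z t = a ∧ Z.ζ1 t = b

/-- The partial derivative `∂_p φ` of a real function. -/
noncomputable def pd [DecidableEq ι] (φ : Vec ι → ℝ) (p : ι) (w : Vec ι) : ℝ :=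
  fderiv ℝ φ w (EuclideanSpace.single p 1)

/-- The composition `φ(z)` of a controlled path with a function, as a triple:
`(ζ̂¹)^{mj} = ∂_p φ^m(z) (ζ¹)^{pj}` and
`(ζ̂²)^{mjk} = ∂_p φ^m(z) (ζ²)^{pjk} + ∂_{pq} φ^m(z) (ζ¹)^{pj} (ζ¹)^{qk}`. -/
noncomputable def Triple.comp [DecidableEq ι] {ι' : Type} [Fintype ι'] (φ : Vec ι → Vec ι')
    (Z : Triple T d ι) : Triple T d ι' where
  z t := φ (Z.z t)
  ζ1 t := WithLp.toLp 2 fun m =>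
    ∑ p, pd (fun w => φ w m.1) p (Z.z t) * Z.ζ1 t (p, m.2)
  ζ2 t := WithLp.toLp 2 fun m =>
    (∑ p, pd (fun w => φ w m.1) p (Z.z t) * Z.ζ2 t (p, m.2.1, m.2.2))
      + ∑ p, ∑ q, pd (pd (fun w => φ w m.1) p) q (Z.z t)
          * Z.ζ1 t (p, m.2.1) * Z.ζ1 t (q, m.2.2)

end Controlled

section Integral

variable {T : ℝ} {l d : ℕ}

/-- The argument of `Λ` in the rough integral:
`r^{ij} δx^j + ρ^{ijk} (x²)^{kj} + δ(μ²)^{ijk₁k₂} (x³)^{k₂k₁j}`, a product of increments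
being evaluated at `(s,u)` for the left factor and at `(u,t)` for the right one. -/
noncomputable def sewing (X : Driver T d) (m : Triple T d (Fin l × Fin d))
    (s u t : Time T) : Vec (Fin l) :=
  WithLp.toLp 2 fun i =>
    (∑ j, m.r X s u (i, j) * delta1 X.x u t j)
      + (∑ j, ∑ k, m.ρ X s u ((i, j), k) * X.x2 u t (k, j))
      + ∑ j, ∑ k₁, ∑ k₂, delta1 m.ζ2 s u ((i, j), k₁, k₂) * X.x3 u t (k₂, k₁, j)

/-- `δz = J(m dx)`, where
`J(m dx)^i = m^{ij} δx^j + (μ¹)^{ijk} (x²)^{kj} + (μ²)^{ijk₁k₂} (x³)^{k₂k₁j} + Λ(sewing)^i`. -/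
def IsIntegral (X : Driver T d) (m : Triple T d (Fin l × Fin d)) (z : Time T → Vec (Fin l)) :
    Prop :=
  ∃ L : Time T → Time T → Vec (Fin l), IsLambda (sewing X m) L ∧
    ∀ (s t : Time T) (i : Fin l),
      delta1 z s t i =
        (∑ j, m.z s (i, j) * delta1 X.x s t j)
          + (∑ j, ∑ k, m.ζ1 s ((i, j), k) * X.x2 s t (k, j))
          + (∑ j, ∑ k₁, ∑ k₂, m.ζ2 s ((i, j), k₁, k₂) * X.x3 s t (k₂, k₁, j))
          + L s t i

/-- The triple `Z` is the integral of the controlled path `m`, as a controlled path: its first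
component integrates `m`, and its other components are those of the integral, `m` and `μ¹`. -/
def IsControlledIntegral (X : Driver T d) (κ : ℝ) (m : Triple T d (Fin l × Fin d))
    (Z : Triple T d (Fin l)) : Prop :=
  m.IsControlled X κ ∧ IsIntegral X m Z.z ∧ (∀ t, Z.ζ1 t = m.z t) ∧
    ∀ t i j k, Z.ζ2 t (i, j, k) = m.ζ1 t ((i, j), k)

/-- `Y ∈ Q_{κ,a,σ(a)}(ℝ^l)` solves `δy = J(σ(y) dx)`, `y_0 = a`. -/
def IsSolution (X : Driver T d) (κ : ℝ) (σ : Vec (Fin l) → Vec (Fin l × Fin d))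
    (a : Vec (Fin l)) (Y : Triple T d (Fin l)) : Prop :=
  Y.MemQ X κ a (σ a) ∧ IsControlledIntegral X κ (Y.comp σ) Y

end Integral

/-- `φ ∈ C^4_b`: four times continuously differentiable, bounded with its derivatives up to
order four. -/
def IsCb4 {E F : Type} [NormedAddCommGroup E] [NormedSpace ℝ E] [NormedAddCommGroup F]
    [NormedSpace ℝ F] (φ : E → F) : Prop :=
  ContDiff ℝ 4 φ ∧ ∃ B : ℝ, ∀ k : ℕ, k ≤ 4 → ∀ w, ‖iteratedFDeriv ℝ k φ w‖ ≤ B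

/-- The size of the driver in `C_1^γ × C_2^{2γ} × C_2^{3γ}`. -/
noncomputable def Driver.size {T : ℝ} {d : ℕ} (X : Driver T d) (γ : ℝ) : ℝ≥0∞ :=
  norm1 γ X.x + norm2 (2 * γ) X.x2 + norm2 (3 * γ) X.x3

end RoughDiff

/-! Solutions are characterised by a local expansion. Along a solution the controlled components are
y, σ(y) and the derivative of σ along its own columns, so the explicit part of the rough integral is
a third order Euler increment `euler`, and the Λ term is the error `eulerError` of that expansion.
By Chen's relations, δ of this error is `defect`. Hence a solution amounts to a path from a whose
Euler error lies in C_2^{1+}.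

The defect is a sum of products of orders 3+1, 2+2 and 1+3 in h^γ, where h = |t - s|, up to a term
h^γ times the Euler error itself. The order 3 of the first factor is where geometricity enters: the
second order term of Taylor's formula is quadratic in the path, and the area meets the symmetric
Hessian only through its symmetric part. Since 4γ > 1, halving intervals and absorbing the term h^γ
· error (`sewing_gronwall`) improves any error in C_2^{1+} to O(h^{4γ}), with a constant uniform
over drivers of bounded size.

For two drivers the same computation is made on pairs: `Ord` records the order of two quantities
together with that of their difference. Controlling the difference costs one more derivative than
controlling the size, so a third order remainder uses four. The difference of two Euler errors is
then bounded by h^{4γ}(W + ε), with W a bound for |y - y'| and ε the distance of the drivers; so y -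
y' is γ-Hölder with constant proportional to W + ε, and finitely many short time steps eliminate W
(`exists_uniform_bound`). This gives the Lipschitz estimate, and uniqueness as the case of equal
data.

For existence, the Euler scheme on a uniform grid obeys the 4γ bound independently of the mesh, by a
discrete version of the halving argument. The values of the schemes stay in a compact ball; a limit
along an ultrafilter keeps the bound, and the limit path, with the components prescribed by σ, is a
solution. -/

namespace RoughDiff

open Asymptotics Filter

/-! ### Functions with bounded partial derivatives -/

section BoundedDerivatives

variable {ι : Type} [Fintype ι] [DecidableEq ι]

/-- `F` is bounded and has bounded iterated partial derivatives up to order `n`. -/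
def CbPd : ℕ → (Vec ι → ℝ) → Prop
  | 0, F => ∃ B : ℝ, ∀ w, |F w| ≤ B
  | n + 1, F => (∃ B : ℝ, ∀ w, |F w| ≤ B) ∧ Differentiable ℝ F ∧ ∀ p, CbPd n (pd F p)

theorem CbPd.bounded {n : ℕ} {F : Vec ι → ℝ} (h : CbPd n F) : ∃ B : ℝ, ∀ w, |F w| ≤ B := by
  cases n with
  | zero => exact h
  | succ n => exact h.1

theorem CbPd.mono {n : ℕ} {F : Vec ι → ℝ} (h : CbPd (n + 1) F) : CbPd n F := by
  induction n generalizing F with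
  | zero => exact h.1
  | succ n ih => exact ⟨h.1, h.2.1, fun p => ih (h.2.2 p)⟩

theorem CbPd.add {n : ℕ} {F G : Vec ι → ℝ} (hF : CbPd n F) (hG : CbPd n G) :
    CbPd n (fun w => F w + G w) := by
  have hb : ∃ B : ℝ, ∀ w, |F w + G w| ≤ B := by
    obtain ⟨B, hB⟩ := hF.bounded
    obtain ⟨C, hC⟩ := hG.bounded
    exact ⟨B + C, fun w => (abs_add_le _ _).trans (add_le_add (hB w) (hC w))⟩
  induction n generalizing F G with
  | zero => exact hb
  | succ n ih =>
    refine ⟨hb, hF.2.1.add hG.2.1, fun p => ?_⟩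
    have : pd (fun w => F w + G w) p = fun w => pd F p w + pd G p w := by
      funext w
      simp only [pd]
      rw [fderiv_fun_add (hF.2.1 w) (hG.2.1 w)]
      rfl
    rw [this]
    refine ih (hF.2.2 p) (hG.2.2 p) ?_
    obtain ⟨B, hB⟩ := (hF.2.2 p).bounded
    obtain ⟨C, hC⟩ := (hG.2.2 p).bounded
    exact ⟨B + C, fun w => (abs_add_le _ _).trans (add_le_add (hB w) (hC w))⟩

theorem pd_mul {F G : Vec ι → ℝ} (hF : Differentiable ℝ F) (hG : Differentiable ℝ G) (p : ι)
    (w : Vec ι) : pd (fun w => F w * G w) p w = F w * pd G p w + G w * pd F p w := by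
  simp only [pd]
  rw [fderiv_fun_mul (hF w) (hG w)]
  rfl

theorem CbPd.mul {n : ℕ} {F G : Vec ι → ℝ} (hF : CbPd n F) (hG : CbPd n G) :
    CbPd n (fun w => F w * G w) := by
  have hb : ∀ F G : Vec ι → ℝ, (∃ B : ℝ, ∀ w, |F w| ≤ B) → (∃ B : ℝ, ∀ w, |G w| ≤ B) →
      ∃ B : ℝ, ∀ w, |F w * G w| ≤ B := by
    rintro F G ⟨B, hB⟩ ⟨C, hC⟩
    exact ⟨B * C, fun w => (abs_mul _ _).trans_le
      (mul_le_mul (hB w) (hC w) (abs_nonneg _) ((abs_nonneg _).trans (hB w)))⟩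
  induction n generalizing F G with
  | zero => exact hb _ _ hF hG
  | succ n ih =>
    refine ⟨hb _ _ hF.bounded hG.bounded, hF.2.1.mul hG.2.1, fun p => ?_⟩
    have : pd (fun w => F w * G w) p = fun w => F w * pd G p w + G w * pd F p w :=
      funext (pd_mul hF.2.1 hG.2.1 p)
    rw [this]
    exact (ih hF.mono (hG.2.2 p)).add (ih hG.mono (hF.2.2 p))

theorem CbPd.zero (n : ℕ) : CbPd n (fun _ : Vec ι => (0 : ℝ)) := by
  induction n with
  | zero => exact ⟨0, by simp⟩
  | succ n ih =>
    refine ⟨⟨0, by simp⟩, differentiable_const _, fun p => ?_⟩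
    have : pd (fun _ : Vec ι => (0 : ℝ)) p = fun _ => 0 := by
      funext w
      simp [pd]
    rwa [this]

theorem CbPd.sum {n : ℕ} {α : Type*} (s : Finset α) {F : α → Vec ι → ℝ}
    (h : ∀ x ∈ s, CbPd n (F x)) : CbPd n (fun w => ∑ x ∈ s, F x w) := by
  classical
  induction s using Finset.induction_on with
  | empty => simpa using CbPd.zero n
  | insert x s hx ih =>
    simp only [Finset.sum_insert hx]
    exact (h x (by simp)).add (ih fun y hy => h y (by simp [hy]))

theorem clm_apply_eq_sum (L : Vec ι →L[ℝ] ℝ) (v : Vec ι) :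
    L v = ∑ p, v p * L (EuclideanSpace.single p 1) := by
  conv_lhs => rw [← (EuclideanSpace.basisFun ι ℝ).sum_repr v]
  simp [map_sum]

theorem CbPd.lipschitz {F : Vec ι → ℝ} (h : CbPd 1 F) :
    ∃ C : ℝ, ∀ v w, |F v - F w| ≤ C * ‖v - w‖ := by
  choose B hB using fun p => (h.2.2 p).bounded
  refine ⟨∑ p, B p, fun v w => ?_⟩
  -- Mean value inequality on the whole space; the differential is bounded by the sum of the bounds
  -- of the partial derivatives.
  refine Convex.norm_image_sub_le_of_norm_fderiv_le (𝕜 := ℝ) (s := Set.univ)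
    (fun x _ => h.2.1 x) (fun x _ => ?_) convex_univ trivial trivial
  refine ContinuousLinearMap.opNorm_le_bound _
    (Finset.sum_nonneg fun p _ => (abs_nonneg _).trans (hB p 0)) fun u => ?_
  rw [clm_apply_eq_sum, Finset.sum_mul]
  refine (norm_sum_le _ _).trans (Finset.sum_le_sum fun p _ => ?_)
  rw [norm_mul, mul_comm]
  exact mul_le_mul (hB p x) (PiLp.norm_apply_le u p) (norm_nonneg _)
    ((abs_nonneg _).trans (hB p 0))

theorem contDiff_pd {n : ℕ} {F : Vec ι → ℝ} (hF : ContDiff ℝ (n + 1 : ℕ) F) (p : ι) :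
    ContDiff ℝ n (pd F p) :=
  (hF.fderiv_right (m := n) (by norm_cast)).clm_apply contDiff_const

/-- A partial derivative is evaluation at a basis vector composed with `fderiv`, and the k-th
derivative of `fderiv ℝ F` has the norm of the (k+1)-st derivative of F, so each induction step uses
up one order. -/
theorem CbPd.of_iteratedFDeriv {n : ℕ} {F : Vec ι → ℝ} (hF : ContDiff ℝ n F)
    (hb : ∃ B : ℝ, ∀ k : ℕ, k ≤ n → ∀ w, ‖iteratedFDeriv ℝ k F w‖ ≤ B) : CbPd n F := by
  have h0 : ∀ {n : ℕ} {F : Vec ι → ℝ},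
      (∃ B : ℝ, ∀ k : ℕ, k ≤ n → ∀ w, ‖iteratedFDeriv ℝ k F w‖ ≤ B) →
      ∃ B : ℝ, ∀ w, |F w| ≤ B := by
    rintro n F ⟨B, hB⟩
    exact ⟨B, fun w => by simpa using hB 0 (Nat.zero_le _) w⟩
  induction n generalizing F with
  | zero => exact h0 hb
  | succ n ih =>
    refine ⟨h0 hb, hF.differentiable (by simp), fun p => ?_⟩
    refine ih (contDiff_pd hF p) ?_
    obtain ⟨B, hB⟩ := hb
    let L : (Vec ι →L[ℝ] ℝ) →L[ℝ] ℝ :=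
      ContinuousLinearMap.apply ℝ ℝ (EuclideanSpace.single p (1 : ℝ))
    refine ⟨‖L‖ * B, fun k hk w => ?_⟩
    have e : pd F p = L ∘ fderiv ℝ F := rfl
    have hc : ContDiff ℝ n (fderiv ℝ F) := hF.fderiv_right (m := n) (by norm_cast)
    rw [e]
    refine (L.norm_iteratedFDeriv_comp_left hc.contDiffAt (by exact_mod_cast hk)).trans ?_
    rw [norm_iteratedFDeriv_fderiv]
    exact mul_le_mul_of_nonneg_left (hB _ (by omega) _) (norm_nonneg _)

theorem pd_pd_comm {F : Vec ι → ℝ} (hF : ContDiff ℝ 2 F) (p q : ι) (w : Vec ι) :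
    pd (pd F p) q w = pd (pd F q) p w := by
  have hd : Differentiable ℝ (fderiv ℝ F) :=
    (hF.fderiv_right (m := 1) (by norm_num)).differentiable (by simp)
  have key : ∀ p q, pd (pd F p) q w = fderiv ℝ (fderiv ℝ F) w (EuclideanSpace.single q 1)
      (EuclideanSpace.single p 1) := by
    intro p q
    have e : pd F p = fun v => fderiv ℝ F v (EuclideanSpace.single p 1) := rfl
    rw [e, pd, fderiv_clm_apply (hd w) (differentiableAt_const _)]
    simp
  rw [key, key]
  exact (hF.contDiffAt.isSymmSndFDerivAt (by simp)).eq _ _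

end BoundedDerivatives

/-! ### Pairs of quantities of a given order -/

section Order

variable {P : Type*}

/-- `f` and `f'` are of order `lam ^ k`, and their difference is of order `lam ^ k * om`,
uniformly in the parameter. -/
structure Ord (lam om : P → ℝ) (k : ℕ) (f f' : P → ℝ) : Prop where
  left : f =O[⊤] fun p => lam p ^ k
  right : f' =O[⊤] fun p => lam p ^ k
  diff : (fun p => f p - f' p) =O[⊤] fun p => lam p ^ k * om p

variable {lam om : P → ℝ} {k m : ℕ} {f f' g g' : P → ℝ}

theorem Ord.add (hf : Ord lam om k f f') (hg : Ord lam om k g g') :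
    Ord lam om k (fun p => f p + g p) (fun p => f' p + g' p) where
  left := hf.left.add hg.left
  right := hf.right.add hg.right
  diff := (hf.diff.add hg.diff).congr_left fun p => by ring

theorem Ord.sub (hf : Ord lam om k f f') (hg : Ord lam om k g g') :
    Ord lam om k (fun p => f p - g p) (fun p => f' p - g' p) where
  left := hf.left.sub hg.left
  right := hf.right.sub hg.right
  diff := (hf.diff.sub hg.diff).congr_left fun p => by ring

/-- Orders add because f g - f' g' = (f - f') g + f' (g - g'). -/
theorem Ord.mul (hf : Ord lam om k f f') (hg : Ord lam om m g g') :
    Ord lam om (k + m) (fun p => f p * g p) (fun p => f' p * g' p) where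
  left := (hf.left.mul hg.left).congr_right fun p => by ring
  right := (hf.right.mul hg.right).congr_right fun p => by ring
  diff := by
    have h1 := (hf.diff.mul hg.left).congr_right (g₂ := fun p => lam p ^ (k + m) * om p)
      fun p => by ring
    have h2 := (hf.right.mul hg.diff).congr_right (g₂ := fun p => lam p ^ (k + m) * om p)
      fun p => by ring
    exact (h1.add h2).congr_left fun p => by ring

theorem Ord.zero (lam om : P → ℝ) (k : ℕ) : Ord lam om k (fun _ => 0) (fun _ => 0) where
  left := isBigO_zero _ _
  right := isBigO_zero _ _
  diff := (isBigO_zero (E' := ℝ) _ _).congr_left fun p => by simp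

theorem Ord.sum {α : Type*} (s : Finset α) {f f' : α → P → ℝ}
    (h : ∀ x ∈ s, Ord lam om k (f x) (f' x)) :
    Ord lam om k (fun p => ∑ x ∈ s, f x p) (fun p => ∑ x ∈ s, f' x p) := by
  classical
  induction s using Finset.induction_on with
  | empty => simpa using Ord.zero lam om k
  | insert x s hx ih =>
    simp only [Finset.sum_insert hx]
    exact (h x (by simp)).add (ih fun y hy => h y (by simp [hy]))

theorem Ord.const (lam om : P → ℝ) (c : ℝ) : Ord lam om 0 (fun _ => c) (fun _ => c) where
  left := isBigO_top.2 ⟨|c|, fun p => by simp⟩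
  right := isBigO_top.2 ⟨|c|, fun p => by simp⟩
  diff := (isBigO_zero (E' := ℝ) _ _).congr_left fun p => by simp

theorem Ord.const_mul (c : ℝ) (hf : Ord lam om k f f') :
    Ord lam om k (fun p => c * f p) (fun p => c * f' p) := by
  simpa using (Ord.const lam om c).mul hf

theorem isBigO_pow_of_le (hl : lam =O[⊤] fun _ => (1 : ℝ)) (hkm : k ≤ m) :
    (fun p => lam p ^ m) =O[⊤] fun p => lam p ^ k := by
  obtain ⟨n, rfl⟩ := Nat.exists_eq_add_of_le hkm
  have := (isBigO_refl (fun p => lam p ^ k) ⊤).mul (hl.pow n)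
  exact (this.congr_left fun p => by ring).congr_right fun p => by simp

theorem Ord.weaken (hl : lam =O[⊤] fun _ => (1 : ℝ)) (hf : Ord lam om m f f') (hkm : k ≤ m) :
    Ord lam om k f f' where
  left := hf.left.trans (isBigO_pow_of_le hl hkm)
  right := hf.right.trans (isBigO_pow_of_le hl hkm)
  diff := hf.diff.trans ((isBigO_pow_of_le hl hkm).mul (isBigO_refl _ _))

theorem Ord.congr {f₁ f₁' : P → ℝ} (hf : Ord lam om k f f') (h : ∀ p, f p = f₁ p)
    (h' : ∀ p, f' p = f₁' p) : Ord lam om k f₁ f₁' := by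
  rwa [← funext h, ← funext h']

theorem Ord.comp {Q : Type*} (hf : Ord lam om k f f') (φ : Q → P) :
    Ord (fun q => lam (φ q)) (fun q => om (φ q)) k (fun q => f (φ q)) (fun q => f' (φ q)) where
  left := hf.left.comp_tendsto tendsto_top
  right := hf.right.comp_tendsto tendsto_top
  diff := hf.diff.comp_tendsto tendsto_top

theorem norm_sub_le_of_deriv {f g : ℝ → ℝ} {C : ℝ}
    (hf : ∀ θ ∈ Set.Icc (0 : ℝ) 1, HasDerivAt f (g θ) θ)
    (hg : ∀ θ ∈ Set.Icc (0 : ℝ) 1, ‖g θ‖ ≤ C) : ‖f 1 - f 0‖ ≤ C :=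
  norm_image_sub_le_of_norm_deriv_le_segment_01'
    (fun θ hθ => (hf θ hθ).hasDerivWithinAt) fun θ hθ => hg θ ⟨hθ.1, hθ.2.le⟩

/-- Adjoining θ ∈ [0,1] to the parameter makes the bound on the derivative uniform in θ, so the mean
value inequality applies for every p with the same constant. -/
theorem isBigO_of_deriv {f g : P → ℝ → ℝ} {e : P → ℝ}
    (hf : ∀ p, ∀ θ ∈ Set.Icc (0 : ℝ) 1, HasDerivAt (f p) (g p θ) θ)
    (hg : (fun q : P × Set.Icc (0 : ℝ) 1 => g q.1 q.2) =O[⊤] fun q => e q.1) :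
    (fun p => f p 1 - f p 0) =O[⊤] e := by
  obtain ⟨C, hC⟩ := isBigO_top.1 hg
  exact isBigO_top.2 ⟨C, fun p =>
    norm_sub_le_of_deriv (hf p) fun θ hθ => hC (p, ⟨θ, hθ⟩)⟩

theorem Ord.of_deriv {f f' g g' : P → ℝ → ℝ}
    (hf : ∀ p, ∀ θ ∈ Set.Icc (0 : ℝ) 1, HasDerivAt (f p) (g p θ) θ)
    (hf' : ∀ p, ∀ θ ∈ Set.Icc (0 : ℝ) 1, HasDerivAt (f' p) (g' p θ) θ)
    (hg : Ord (fun q : P × Set.Icc (0 : ℝ) 1 => lam q.1) (fun q => om q.1) k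
      (fun q => g q.1 q.2) (fun q => g' q.1 q.2)) :
    Ord lam om k (fun p => f p 1 - f p 0) (fun p => f' p 1 - f' p 0) where
  left := isBigO_of_deriv hf hg.left
  right := isBigO_of_deriv hf' hg.right
  diff := by
    have := isBigO_of_deriv (f := fun p θ => f p θ - f' p θ) (g := fun p θ => g p θ - g' p θ)
      (e := fun p => lam p ^ k * om p) (fun p θ hθ => (hf p θ hθ).sub (hf' p θ hθ)) hg.diff
    exact this.congr_left fun p => by ring

end Order

/-! ### Taylor expansions of pairs -/

section Taylor

variable {P : Type*} {ι : Type} [Fintype ι] [DecidableEq ι] {lam om : P → ℝ}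
  {a a' Δ Δ' : P → Vec ι} {F : Vec ι → ℝ}

theorem isBigO_of_coord {f : P → Vec ι} {e : P → ℝ} (h : ∀ i, (fun p => f p i) =O[⊤] e) :
    f =O[⊤] e := by
  have : (fun p => ∑ i, f p i • EuclideanSpace.single i (1 : ℝ)) =O[⊤] e := by
    refine IsBigO.fun_sum fun i _ => ?_
    refine (isBigO_of_le _ fun p => ?_).trans (h i)
    rw [norm_smul]
    simp
  refine this.congr_left fun p => ?_
  conv_rhs => rw [← (EuclideanSpace.basisFun ι ℝ).sum_repr (f p)]
  simp

/-- The difference is controlled by the Lipschitz constant of F. This is the derivative that every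
estimate on pairs spends beyond what the size alone would need. -/
theorem Ord.apply (hF : CbPd 1 F) (ha : (fun p => a p - a' p) =O[⊤] om) :
    Ord lam om 0 (fun p => F (a p)) (fun p => F (a' p)) := by
  obtain ⟨B, hB⟩ := hF.bounded
  obtain ⟨C, hC⟩ := hF.lipschitz
  refine ⟨isBigO_top.2 ⟨B, fun p => ?_⟩, isBigO_top.2 ⟨B, fun p => ?_⟩, ?_⟩
  · simpa using hB (a p)
  · simpa using hB (a' p)
  · have : (fun p => F (a p) - F (a' p)) =O[⊤] fun p => a p - a' p :=
      isBigO_top.2 ⟨C, fun p => hC _ _⟩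
    simpa using this.trans ha

theorem hasDerivAt_comp_line (hF : Differentiable ℝ F) (v u : Vec ι) (θ : ℝ) :
    HasDerivAt (fun θ : ℝ => F (v + θ • u)) (∑ p, u p * pd F p (v + θ • u)) θ := by
  have h1 : HasDerivAt (fun θ : ℝ => v + θ • u) u θ := by
    simpa using ((hasDerivAt_id θ).smul_const u).const_add v
  have h2 := (hF (v + θ • u)).hasFDerivAt.comp_hasDerivAt θ h1
  rw [clm_apply_eq_sum] at h2
  exact h2

theorem isBigO_line (hl : lam =O[⊤] fun _ => (1 : ℝ)) (ha : (fun p => a p - a' p) =O[⊤] om)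
    (hΔ : ∀ i, Ord lam om 1 (fun p => Δ p i) (fun p => Δ' p i)) :
    (fun q : P × Set.Icc (0 : ℝ) 1 => (a q.1 + (q.2 : ℝ) • Δ q.1) -
      (a' q.1 + (q.2 : ℝ) • Δ' q.1)) =O[⊤] fun q => om q.1 := by
  have h1 : (fun p => Δ p - Δ' p) =O[⊤] om := by
    refine isBigO_of_coord fun i => ?_
    have := (hΔ i).weaken hl (Nat.zero_le 1)
    simpa using this.diff
  have h2 : (fun q : P × Set.Icc (0 : ℝ) 1 => (q.2 : ℝ) • (Δ q.1 - Δ' q.1)) =O[⊤]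
      fun q => om q.1 := by
    have h3 : (fun q : P × Set.Icc (0 : ℝ) 1 => Δ q.1 - Δ' q.1) =O[⊤] fun q => om q.1 :=
      h1.comp_tendsto tendsto_top
    refine (isBigO_of_le _ fun q => ?_).trans h3
    rw [norm_smul, Real.norm_of_nonneg q.2.2.1]
    exact mul_le_of_le_one_left (norm_nonneg _) q.2.2.2
  have h4 : (fun q : P × Set.Icc (0 : ℝ) 1 => a q.1 - a' q.1) =O[⊤] fun q => om q.1 :=
    ha.comp_tendsto tendsto_top
  exact (h4.add h2).congr_left fun q => by rw [smul_sub]; abel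

theorem Ord.theta_mul {k : ℕ} {f f' : P → ℝ} (hf : Ord lam om k f f') :
    Ord (fun q : P × Set.Icc (0 : ℝ) 1 => lam q.1) (fun q => om q.1) k
      (fun q => (q.2 : ℝ) * f q.1) (fun q => (q.2 : ℝ) * f' q.1) := by
  have h0 : Ord (fun q : P × Set.Icc (0 : ℝ) 1 => lam q.1) (fun q => om q.1) 0
      (fun q => (q.2 : ℝ)) (fun q => (q.2 : ℝ)) := by
    have h : (fun q : P × Set.Icc (0 : ℝ) 1 => (q.2 : ℝ)) =O[⊤] fun q => lam q.1 ^ 0 := by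
      refine isBigO_of_le _ fun q => ?_
      simpa [abs_of_nonneg q.2.2.1] using q.2.2.2
    exact ⟨h, h, (isBigO_zero (E' := ℝ) _ _).congr_left fun p => by simp⟩
  simpa using h0.mul (hf.comp Prod.fst)

/-- The derivative of F along the segment from a to a + Δ is a sum of Δ_i (order 1) times values of
∂_i F (order 0), so `Ord.of_deriv` applies. -/
theorem Ord.taylor_one (hl : lam =O[⊤] fun _ => (1 : ℝ)) (hF : CbPd 2 F)
    (ha : (fun p => a p - a' p) =O[⊤] om)
    (hΔ : ∀ i, Ord lam om 1 (fun p => Δ p i) (fun p => Δ' p i)) :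
    Ord lam om 1 (fun p => F (a p + Δ p) - F (a p)) (fun p => F (a' p + Δ' p) - F (a' p)) := by
  refine (Ord.of_deriv (fun p θ _ => hasDerivAt_comp_line hF.2.1 (a p) (Δ p) θ)
    (fun p θ _ => hasDerivAt_comp_line hF.2.1 (a' p) (Δ' p) θ)
    (Ord.sum _ fun i _ => ?_)).congr (fun p => by simp) fun p => by simp
  exact ((hΔ i).comp Prod.fst).mul (Ord.apply (hF.2.2 i) (isBigO_line hl ha hΔ))

/-- After subtraction of the linear term, the θ-derivative is Δ_i times the increment of ∂_i F over
θΔ, which has order 1 by the previous expansion. -/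
theorem Ord.taylor_two (hl : lam =O[⊤] fun _ => (1 : ℝ)) (hF : CbPd 3 F)
    (ha : (fun p => a p - a' p) =O[⊤] om)
    (hΔ : ∀ i, Ord lam om 1 (fun p => Δ p i) (fun p => Δ' p i)) :
    Ord lam om 2 (fun p => F (a p + Δ p) - F (a p) - ∑ i, Δ p i * pd F i (a p))
      (fun p => F (a' p + Δ' p) - F (a' p) - ∑ i, Δ' p i * pd F i (a' p)) := by
  have hd : ∀ (v u : Vec ι) (θ : ℝ),
      HasDerivAt (fun θ : ℝ => F (v + θ • u) - θ * ∑ i, u i * pd F i v)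
        (∑ i, u i * (pd F i (v + θ • u) - pd F i v)) θ := by
    intro v u θ
    have := (hasDerivAt_comp_line hF.2.1 v u θ).sub
      ((hasDerivAt_id θ).mul_const (∑ i, u i * pd F i v))
    refine HasDerivAt.congr_deriv this ?_
    simp [mul_sub, Finset.sum_sub_distrib]
  refine (Ord.of_deriv (fun p θ _ => hd (a p) (Δ p) θ) (fun p θ _ => hd (a' p) (Δ' p) θ)
    (Ord.sum _ fun i _ => ?_)).congr (fun p => by simp; ring) fun p => by simp; ring
  refine ((hΔ i).comp Prod.fst).mul (Ord.taylor_one (hl.comp_tendsto tendsto_top) (hF.2.2 i)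
    (ha.comp_tendsto tendsto_top) fun j => ?_)
  simpa using (hΔ j).theta_mul

/-- The pattern repeats: the θ-derivative of the remainder is Δ_i times the second order remainder
of ∂_i F with step θΔ. -/
theorem Ord.taylor_three (hl : lam =O[⊤] fun _ => (1 : ℝ)) (hF : CbPd 4 F)
    (ha : (fun p => a p - a' p) =O[⊤] om)
    (hΔ : ∀ i, Ord lam om 1 (fun p => Δ p i) (fun p => Δ' p i)) :
    Ord lam om 3
      (fun p => F (a p + Δ p) - F (a p) - (∑ i, Δ p i * pd F i (a p))
        - (1 / 2) * ∑ i, Δ p i * ∑ j, Δ p j * pd (pd F i) j (a p))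
      (fun p => F (a' p + Δ' p) - F (a' p) - (∑ i, Δ' p i * pd F i (a' p))
        - (1 / 2) * ∑ i, Δ' p i * ∑ j, Δ' p j * pd (pd F i) j (a' p)) := by
  have hd : ∀ (v u : Vec ι) (θ : ℝ),
      HasDerivAt (fun θ : ℝ => F (v + θ • u) - θ * (∑ i, u i * pd F i v)
          - θ ^ 2 * ((1 / 2) * ∑ i, u i * ∑ j, u j * pd (pd F i) j v))
        (∑ i, u i * (pd F i (v + θ • u) - pd F i v
          - ∑ j, (θ • u) j * pd (pd F i) j v)) θ := by
    intro v u θ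
    have := ((hasDerivAt_comp_line hF.2.1 v u θ).sub
      ((hasDerivAt_id θ).mul_const (∑ i, u i * pd F i v))).sub
      ((hasDerivAt_pow 2 θ).mul_const ((1 / 2) * ∑ i, u i * ∑ j, u j * pd (pd F i) j v))
    refine HasDerivAt.congr_deriv this ?_
    have e : ∀ i, ∑ j, (θ • u) j * pd (pd F i) j v = θ * ∑ j, u j * pd (pd F i) j v := by
      intro i
      rw [Finset.mul_sum]
      exact Finset.sum_congr rfl fun j _ => by simp [mul_assoc]
    simp only [e, mul_sub, Finset.sum_sub_distrib]
    have e2 : ∑ i, u i * (θ * ∑ j, u j * pd (pd F i) j v) =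
        θ * ∑ i, u i * ∑ j, u j * pd (pd F i) j v := by
      rw [Finset.mul_sum]
      exact Finset.sum_congr rfl fun j _ => by ring
    rw [e2]
    push_cast
    ring
  refine (Ord.of_deriv (fun p θ _ => hd (a p) (Δ p) θ) (fun p θ _ => hd (a' p) (Δ' p) θ)
    (Ord.sum _ fun i _ => ?_)).congr (fun p => by simp; ring) fun p => by simp; ring
  refine ((hΔ i).comp Prod.fst).mul (Ord.taylor_two (hl.comp_tendsto tendsto_top) (hF.2.2 i)
    (ha.comp_tendsto tendsto_top) fun j => ?_)
  simpa using (hΔ j).theta_mul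

end Taylor

/-! ### Coefficients of the Euler expansion -/

section Coefficients

variable {l d : ℕ}

/-- The values over `(s,t)` of the path, of the area and of the volume of a driver. -/
structure Incr (d : ℕ) where
  x1 : Vec (Fin d)
  x2 : Vec (Fin d × Fin d)
  x3 : Vec (Fin d × Fin d × Fin d)

/-- The increment of a driver over `(s,t)`. -/
noncomputable def Driver.inc {T : ℝ} (X : Driver T d) (s t : Time T) : Incr d :=
  ⟨delta1 X.x s t, X.x2 s t, X.x3 s t⟩

/-- The relation between path and area in a geometric driver. -/
def Incr.IsGeometric (ξ : Incr d) : Prop :=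
  ∀ i j, ξ.x2 (i, j) + ξ.x2 (j, i) = ξ.x1 i * ξ.x1 j

variable (σ : Vec (Fin l) → Vec (Fin l × Fin d))

/-- `∂_p σ^m σ^{pk}`. -/
noncomputable def cof1 (m : Fin l × Fin d) (k : Fin d) (y : Vec (Fin l)) : ℝ :=
  ∑ p, pd (fun w => σ w m) p y * σ y (p, k)

/-- `∂_p σ^m ∂_q σ^{pj} σ^{qk} + ∂_{pq} σ^m σ^{pj} σ^{qk}`. -/
noncomputable def cof2 (m : Fin l × Fin d) (j k : Fin d) (y : Vec (Fin l)) : ℝ :=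
  (∑ p, pd (fun w => σ w m) p y * cof1 σ (p, j) k y)
    + ∑ p, ∑ q, pd (pd (fun w => σ w m) p) q y * σ y (p, j) * σ y (q, k)

/-- The third order Euler increment from the point `y`. -/
noncomputable def euler (ξ : Incr d) (y : Vec (Fin l)) : Vec (Fin l) :=
  WithLp.toLp 2 fun i =>
    (∑ j, σ y (i, j) * ξ.x1 j)
      + (∑ j, ∑ k, cof1 σ (i, j) k y * ξ.x2 (k, j))
      + ∑ j, ∑ k₁, ∑ k₂, cof2 σ (i, j) k₁ k₂ y * ξ.x3 (k₂, k₁, j)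

/-- The remainder of the second order expansion of `σ`. -/
noncomputable def rem0 (ξ : Incr d) (a b : Vec (Fin l)) (m : Fin l × Fin d) : ℝ :=
  σ b m - σ a m - (∑ k, cof1 σ m k a * ξ.x1 k) - ∑ j, ∑ k, cof2 σ m j k a * ξ.x2 (k, j)

/-- The remainder of the first order expansion of `cof1 σ`. -/
noncomputable def rem1 (ξ : Incr d) (a b : Vec (Fin l)) (m : Fin l × Fin d) (j : Fin d) : ℝ :=
  cof1 σ m j b - cof1 σ m j a - ∑ k, cof2 σ m j k a * ξ.x1 k

/-- The defect of additivity of the Euler increments over two consecutive intervals. -/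
noncomputable def defect (ξ η : Incr d) (a b : Vec (Fin l)) : Vec (Fin l) :=
  WithLp.toLp 2 fun i =>
    (∑ j, rem0 σ ξ a b (i, j) * η.x1 j)
      + (∑ j, ∑ k, rem1 σ ξ a b (i, j) k * η.x2 (k, j))
      + ∑ j, ∑ k₁, ∑ k₂, (cof2 σ (i, j) k₁ k₂ b - cof2 σ (i, j) k₁ k₂ a) * η.x3 (k₂, k₁, j)

/-- Componentwise regularity of the vector field. -/
structure IsRegular : Prop where
  cb : ∀ m, CbPd 4 fun w => σ w m
  contDiff : ∀ m, ContDiff ℝ 2 fun w => σ w m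

variable {σ}

theorem IsCb4.isRegular (h : IsCb4 σ) : IsRegular σ := by
  obtain ⟨hc, B, hB⟩ := h
  have hm : ∀ m, ContDiff ℝ 4 fun w => σ w m := fun m =>
    (EuclideanSpace.proj (𝕜 := ℝ) m).contDiff.comp hc
  refine ⟨fun m => CbPd.of_iteratedFDeriv (hm m) ?_, fun m => (hm m).of_le (by norm_num)⟩
  let L : Vec (Fin l × Fin d) →L[ℝ] ℝ := EuclideanSpace.proj m
  refine ⟨‖L‖ * B, fun k hk w => ?_⟩
  refine (L.norm_iteratedFDeriv_comp_left hc.contDiffAt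
    (by exact_mod_cast hk)).trans ?_
  exact mul_le_mul_of_nonneg_left (hB k hk w) (norm_nonneg _)

theorem IsRegular.cof1 (h : IsRegular σ) (m : Fin l × Fin d) (k : Fin d) :
    CbPd 3 (cof1 σ m k) :=
  CbPd.sum _ fun p _ => ((h.cb m).2.2 p).mul (h.cb (p, k)).mono

theorem IsRegular.cof2 (h : IsRegular σ) (m : Fin l × Fin d) (j k : Fin d) :
    CbPd 2 (cof2 σ m j k) :=
  (CbPd.sum _ fun p _ => ((h.cb m).2.2 p).mono.mul (h.cof1 (p, j) k).mono).add
    (CbPd.sum _ fun p _ => CbPd.sum _ fun q _ =>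
      ((((h.cb m).2.2 p).2.2 q).mul (h.cb (p, j)).mono.mono).mul (h.cb (q, k)).mono.mono)

theorem pd_sum {ι : Type} [Fintype ι] [DecidableEq ι] {α : Type*} (s : Finset α)
    {F : α → Vec ι → ℝ} (hF : ∀ x ∈ s, Differentiable ℝ (F x)) (p : ι) (w : Vec ι) :
    pd (fun w => ∑ x ∈ s, F x w) p w = ∑ x ∈ s, pd (F x) p w := by
  simp only [pd]
  rw [fderiv_fun_sum fun x hx => hF x hx w]
  simp

/-- By the product rule, the second coefficient is the derivative of the first one along the columns
of σ; this is what makes `rem1` a first order Taylor remainder. -/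
theorem IsRegular.cof2_eq (h : IsRegular σ) (m : Fin l × Fin d) (j k : Fin d)
    (y : Vec (Fin l)) :
    RoughDiff.cof2 σ m j k y = ∑ q, pd (RoughDiff.cof1 σ m j) q y * σ y (q, k) := by
  have e : ∀ q, pd (RoughDiff.cof1 σ m j) q y = ∑ p, (pd (fun w => σ w m) p y *
      pd (fun w => σ w (p, j)) q y + σ y (p, j) * pd (pd (fun w => σ w m) p) q y) := by
    intro q
    have h1 : ∀ p, Differentiable ℝ (pd (fun w => σ w m) p) := fun p => ((h.cb m).2.2 p).2.1
    have h2 : ∀ p, Differentiable ℝ fun w => σ w (p, j) := fun p => (h.cb (p, j)).2.1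
    refine (pd_sum Finset.univ (fun p _ => (h1 p).mul (h2 p)) q y).trans ?_
    exact Finset.sum_congr rfl fun p _ => pd_mul (h1 p) (h2 p) q y
  simp only [e, RoughDiff.cof2, Finset.sum_mul, add_mul, Finset.sum_add_distrib,
    RoughDiff.cof1, Finset.mul_sum]
  congr 1
  · rw [Finset.sum_comm]
    exact Finset.sum_congr rfl fun q _ => Finset.sum_congr rfl fun p _ => by ring
  · rw [Finset.sum_comm]
    exact Finset.sum_congr rfl fun q _ => Finset.sum_congr rfl fun p _ => by ring

theorem sum_comm_four {α β : Type*} [Fintype α] [Fintype β] (f : α → α → β → β → ℝ) :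
    ∑ j, ∑ k, ∑ p, ∑ q, f j k p q = ∑ p, ∑ q, ∑ j, ∑ k, f j k p q := by
  calc _ = ∑ j, ∑ p, ∑ q, ∑ k, f j k p q := Finset.sum_congr rfl fun j _ => by
        rw [Finset.sum_comm]
        exact Finset.sum_congr rfl fun p _ => Finset.sum_comm
    _ = ∑ p, ∑ q, ∑ j, ∑ k, f j k p q := by
        rw [Finset.sum_comm]
        exact Finset.sum_congr rfl fun p _ => Finset.sum_comm

/-- A symmetric array only sees the symmetric part of the area, which geometricity identifies with
half the tensor square of the path increment. -/
theorem sum_symm_mul_area {ξ : Incr d} (hξ : ξ.IsGeometric) {H : Fin d → Fin d → ℝ}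
    (hH : ∀ j k, H j k = H k j) :
    ∑ j, ∑ k, H j k * ξ.x2 (k, j) = (1 / 2) * ∑ j, ∑ k, H j k * (ξ.x1 j * ξ.x1 k) := by
  have h1 : ∑ j, ∑ k, H j k * ξ.x2 (k, j) = ∑ j, ∑ k, H j k * ξ.x2 (j, k) := by
    rw [Finset.sum_comm]
    exact Finset.sum_congr rfl fun q _ => Finset.sum_congr rfl fun p _ => by rw [hH]
  have h2 : ∑ j, ∑ k, H j k * (ξ.x1 j * ξ.x1 k) =
      (∑ j, ∑ k, H j k * ξ.x2 (j, k)) + ∑ j, ∑ k, H j k * ξ.x2 (k, j) := by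
    simp only [← Finset.sum_add_distrib, ← mul_add]
    exact Finset.sum_congr rfl fun q _ => Finset.sum_congr rfl fun p _ => by rw [hξ q p]
  rw [h2, ← h1]
  ring

/-- In a geometric driver, the second order terms of `rem0` are those of a Taylor expansion. -/
theorem rem0_eq (h : IsRegular σ) {ξ : Incr d} (hξ : ξ.IsGeometric) (a v : Vec (Fin l))
    (m : Fin l × Fin d) :
    rem0 σ ξ a (a + v) m =
      (σ (a + v) m - σ a m - (∑ i, v i * pd (fun w => σ w m) i a)
        - (1 / 2) * ∑ i, v i * ∑ j, v j * pd (pd (fun w => σ w m) i) j a)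
      + (∑ i, (v i - (∑ k, σ a (i, k) * ξ.x1 k) - ∑ j, ∑ k, cof1 σ (i, j) k a * ξ.x2 (k, j))
          * pd (fun w => σ w m) i a)
      + (1 / 2) * ∑ i, ∑ j, (v i * v j - (∑ k, σ a (i, k) * ξ.x1 k) * ∑ k, σ a (j, k) * ξ.x1 k)
          * pd (pd (fun w => σ w m) i) j a := by
  have h1 : ∑ i, (∑ k, σ a (i, k) * ξ.x1 k) * pd (fun w => σ w m) i a =
      ∑ k, cof1 σ m k a * ξ.x1 k := by
    simp only [cof1, Finset.sum_mul]
    rw [Finset.sum_comm]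
    exact Finset.sum_congr rfl fun q _ => Finset.sum_congr rfl fun p _ => by ring
  have h2 : ∑ j, ∑ k, cof2 σ m j k a * ξ.x2 (k, j) =
      (∑ i, (∑ j, ∑ k, cof1 σ (i, j) k a * ξ.x2 (k, j)) * pd (fun w => σ w m) i a) +
      (1 / 2) * ∑ i, ∑ j, ((∑ k, σ a (i, k) * ξ.x1 k) * ∑ k, σ a (j, k) * ξ.x1 k)
          * pd (pd (fun w => σ w m) i) j a := by
    simp only [cof2, add_mul, Finset.sum_add_distrib]
    congr 1
    · simp only [Finset.sum_mul]
      conv_rhs => rw [Finset.sum_comm]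
      refine Finset.sum_congr rfl fun j _ => ?_
      conv_rhs => rw [Finset.sum_comm]
      exact Finset.sum_congr rfl fun q _ => Finset.sum_congr rfl fun p _ => by ring
    -- The Hessian of σ^m contracted with two columns of σ is symmetric in these columns, so the
    -- area may be replaced by the path increments.
    · rw [sum_symm_mul_area hξ]
      · congr 1
        simp only [Finset.sum_mul, Finset.mul_sum]
        rw [sum_comm_four]
        refine Finset.sum_congr rfl fun p _ => Finset.sum_congr rfl fun q _ => ?_
        rw [Finset.sum_comm]
        exact Finset.sum_congr rfl fun j _ => Finset.sum_congr rfl fun k _ => by ring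
      · intro j k
        rw [Finset.sum_comm]
        refine Finset.sum_congr rfl fun q _ => Finset.sum_congr rfl fun p _ => ?_
        rw [pd_pd_comm (h.contDiff m)]
        ring
  simp only [rem0, sub_mul, Finset.sum_sub_distrib, h1, h2]
  have h3 : ∑ i, v i * ∑ j, v j * pd (pd (fun w => σ w m) i) j a =
      ∑ i, ∑ j, v i * v j * pd (pd (fun w => σ w m) i) j a := by
    simp only [Finset.mul_sum, mul_assoc]
  rw [h3]
  ring

/-- Only path increments occur at this order, so the relation between path and area plays no role.
-/
theorem rem1_eq (h : IsRegular σ) (ξ : Incr d) (a v : Vec (Fin l)) (m : Fin l × Fin d)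
    (j : Fin d) :
    rem1 σ ξ a (a + v) m j =
      (cof1 σ m j (a + v) - cof1 σ m j a - ∑ i, v i * pd (cof1 σ m j) i a)
      + ∑ i, (v i - ∑ k, σ a (i, k) * ξ.x1 k) * pd (cof1 σ m j) i a := by
  have h1 : ∑ i, (∑ k, σ a (i, k) * ξ.x1 k) * pd (cof1 σ m j) i a =
      ∑ k, cof2 σ m j k a * ξ.x1 k := by
    simp only [h.cof2_eq, Finset.sum_mul]
    rw [Finset.sum_comm]
    exact Finset.sum_congr rfl fun q _ => Finset.sum_congr rfl fun p _ => by ring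
  simp only [rem1, sub_mul, Finset.sum_sub_distrib, h1]
  ring

end Coefficients

/-! ### Orders of the remainders -/

section OrderRemainders

variable {P : Type*} {l d : ℕ} {σ : Vec (Fin l) → Vec (Fin l × Fin d)} {lam om : P → ℝ}
  {ξ ξ' η η' : P → Incr d} {a a' v v' : P → Vec (Fin l)}

/-- Pairs of increments of the expected orders. -/
structure OrdIncr (lam om : P → ℝ) (ξ ξ' : P → Incr d) : Prop where
  x1 : ∀ i, Ord lam om 1 (fun p => (ξ p).x1 i) fun p => (ξ' p).x1 i
  x2 : ∀ i, Ord lam om 2 (fun p => (ξ p).x2 i) fun p => (ξ' p).x2 i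
  x3 : ∀ i, Ord lam om 3 (fun p => (ξ p).x3 i) fun p => (ξ' p).x3 i

theorem IsRegular.ord (h : IsRegular σ) (ha : (fun p => a p - a' p) =O[⊤] om)
    (m : Fin l × Fin d) : Ord lam om 0 (fun p => σ (a p) m) (fun p => σ (a' p) m) :=
  Ord.apply (h.cb m).mono.mono.mono ha

theorem IsRegular.ord_cof1 (h : IsRegular σ) (ha : (fun p => a p - a' p) =O[⊤] om)
    (m : Fin l × Fin d) (k : Fin d) :
    Ord lam om 0 (fun p => RoughDiff.cof1 σ m k (a p)) (fun p => RoughDiff.cof1 σ m k (a' p)) :=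
  Ord.apply (h.cof1 m k).mono.mono ha

theorem IsRegular.ord_cof2 (h : IsRegular σ) (ha : (fun p => a p - a' p) =O[⊤] om)
    (m : Fin l × Fin d) (j k : Fin d) :
    Ord lam om 0 (fun p => RoughDiff.cof2 σ m j k (a p))
      (fun p => RoughDiff.cof2 σ m j k (a' p)) :=
  Ord.apply (h.cof2 m j k).mono ha

theorem ord_first (h : IsRegular σ) (ha : (fun p => a p - a' p) =O[⊤] om)
    (hξ : OrdIncr lam om ξ ξ') (i : Fin l) :
    Ord lam om 1 (fun p => ∑ k, σ (a p) (i, k) * (ξ p).x1 k)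
      (fun p => ∑ k, σ (a' p) (i, k) * (ξ' p).x1 k) := by
  refine Ord.sum _ fun k _ => ?_
  simpa using (h.ord ha (i, k)).mul (hξ.x1 k)

theorem ord_second (h : IsRegular σ) (ha : (fun p => a p - a' p) =O[⊤] om)
    (hξ : OrdIncr lam om ξ ξ') (i : Fin l) :
    Ord lam om 2 (fun p => ∑ j, ∑ k, cof1 σ (i, j) k (a p) * (ξ p).x2 (k, j))
      (fun p => ∑ j, ∑ k, cof1 σ (i, j) k (a' p) * (ξ' p).x2 (k, j)) := by
  refine Ord.sum _ fun j _ => Ord.sum _ fun k _ => ?_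
  simpa using (h.ord_cof1 ha (i, j) k).mul (hξ.x2 (k, j))

theorem ord_third (h : IsRegular σ) (ha : (fun p => a p - a' p) =O[⊤] om)
    (hξ : OrdIncr lam om ξ ξ') (i : Fin l) :
    Ord lam om 3
      (fun p => ∑ j, ∑ k₁, ∑ k₂, cof2 σ (i, j) k₁ k₂ (a p) * (ξ p).x3 (k₂, k₁, j))
      (fun p => ∑ j, ∑ k₁, ∑ k₂, cof2 σ (i, j) k₁ k₂ (a' p) * (ξ' p).x3 (k₂, k₁, j)) := by
  refine Ord.sum _ fun j _ => Ord.sum _ fun k₁ _ => Ord.sum _ fun k₂ _ => ?_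
  simpa using (h.ord_cof2 ha (i, j) k₁ k₂).mul (hξ.x3 (k₂, k₁, j))

theorem ord_euler (h : IsRegular σ) (hl : lam =O[⊤] fun _ => (1 : ℝ))
    (ha : (fun p => a p - a' p) =O[⊤] om) (hξ : OrdIncr lam om ξ ξ') (i : Fin l) :
    Ord lam om 1 (fun p => euler σ (ξ p) (a p) i) (fun p => euler σ (ξ' p) (a' p) i) :=
  ((ord_first h ha hξ i).add ((ord_second h ha hξ i).weaken hl (by norm_num))).add
    ((ord_third h ha hξ i).weaken hl (by norm_num))

variable {J J' : P → Vec (Fin l)}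

/-- In the decomposition `rem0_eq`, the Taylor remainder has order 3; v minus its first and second
order parts is the volume term plus J, of order 3; the quadratic correction is treated through the
factorisation below. -/
theorem ord_rem0 (h : IsRegular σ) (hl : lam =O[⊤] fun _ => (1 : ℝ))
    (ha : (fun p => a p - a' p) =O[⊤] om) (hξ : OrdIncr lam om ξ ξ')
    (hg : ∀ p, (ξ p).IsGeometric) (hg' : ∀ p, (ξ' p).IsGeometric)
    (hJ : ∀ i, Ord lam om 3 (fun p => J p i) (fun p => J' p i)) (m : Fin l × Fin d) :
    Ord lam om 3 (fun p => rem0 σ (ξ p) (a p) (a p + (euler σ (ξ p) (a p) + J p)) m)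
      (fun p => rem0 σ (ξ' p) (a' p) (a' p + (euler σ (ξ' p) (a' p) + J' p)) m) := by
  simp only [rem0_eq h (hg _), rem0_eq h (hg' _)]
  have hv : ∀ i, Ord lam om 1 (fun p => (euler σ (ξ p) (a p) + J p) i)
      (fun p => (euler σ (ξ' p) (a' p) + J' p) i) := fun i =>
    (ord_euler h hl ha hξ i).add ((hJ i).weaken hl (by norm_num))
  refine ((Ord.taylor_three hl (h.cb m) ha hv).add (Ord.sum _ fun i _ => ?_)).add
    (Ord.const_mul _ (Ord.sum _ fun i _ => Ord.sum _ fun j _ => ?_))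
  · have h1 := ((ord_third h ha hξ i).add (hJ i)).mul
      (Ord.apply (lam := lam) ((h.cb m).2.2 i).mono.mono ha)
    exact h1.congr (fun p => by simp only [euler, PiLp.add_apply]; ring)
      fun p => by simp only [euler, PiLp.add_apply]; ring
  · have hr : ∀ i, Ord lam om 2
        (fun p => (euler σ (ξ p) (a p) + J p) i - ∑ k, σ (a p) (i, k) * (ξ p).x1 k)
        (fun p => (euler σ (ξ' p) (a' p) + J' p) i - ∑ k, σ (a' p) (i, k) * (ξ' p).x1 k) :=
      fun i => (((ord_second h ha hξ i).add ((ord_third h ha hξ i).weaken hl (by norm_num))).add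
        ((hJ i).weaken hl (by norm_num))).congr (fun p => by simp only [euler, PiLp.add_apply]; ring)
          fun p => by simp only [euler, PiLp.add_apply]; ring
    -- With f the first order part of v, v_i v_j - f_i f_j = v_i (v_j - f_j) + (v_i - f_i) f_j, of
    -- order 1 + 2.
    have h1 := ((hv i).mul (hr j)).add
      ((hr i).mul (ord_first h ha hξ j))
    have h2 := h1.mul (Ord.apply (lam := lam) (((h.cb m).2.2 i).2.2 j).mono ha)
    exact h2.congr (fun p => by ring) fun p => by ring

theorem ord_rem1 (h : IsRegular σ) (hl : lam =O[⊤] fun _ => (1 : ℝ))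
    (ha : (fun p => a p - a' p) =O[⊤] om) (hξ : OrdIncr lam om ξ ξ')
    (hJ : ∀ i, Ord lam om 3 (fun p => J p i) (fun p => J' p i)) (m : Fin l × Fin d)
    (j : Fin d) :
    Ord lam om 2 (fun p => rem1 σ (ξ p) (a p) (a p + (euler σ (ξ p) (a p) + J p)) m j)
      (fun p => rem1 σ (ξ' p) (a' p) (a' p + (euler σ (ξ' p) (a' p) + J' p)) m j) := by
  simp only [rem1_eq h]
  have hv : ∀ i, Ord lam om 1 (fun p => (euler σ (ξ p) (a p) + J p) i)
      (fun p => (euler σ (ξ' p) (a' p) + J' p) i) := fun i =>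
    (ord_euler h hl ha hξ i).add ((hJ i).weaken hl (by norm_num))
  refine (Ord.taylor_two hl (h.cof1 m j) ha hv).add (Ord.sum _ fun i _ => ?_)
  have h1 := (((ord_second h ha hξ i).add ((ord_third h ha hξ i).weaken hl (by norm_num))).add
    ((hJ i).weaken hl (by norm_num))).mul
      (Ord.apply (lam := lam) ((h.cof1 m j).2.2 i).mono ha)
  exact h1.congr (fun p => by simp only [euler, PiLp.add_apply]; ring)
    fun p => by simp only [euler, PiLp.add_apply]; ring

theorem ord_rem2 (h : IsRegular σ) (hl : lam =O[⊤] fun _ => (1 : ℝ))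
    (ha : (fun p => a p - a' p) =O[⊤] om) (hξ : OrdIncr lam om ξ ξ')
    (hJ : ∀ i, Ord lam om 3 (fun p => J p i) (fun p => J' p i)) (m : Fin l × Fin d)
    (j k : Fin d) :
    Ord lam om 1
      (fun p => cof2 σ m j k (a p + (euler σ (ξ p) (a p) + J p)) - cof2 σ m j k (a p))
      (fun p => cof2 σ m j k (a' p + (euler σ (ξ' p) (a' p) + J' p)) - cof2 σ m j k (a' p)) :=
  Ord.taylor_one hl (h.cof2 m j k) ha fun i =>
    (ord_euler h hl ha hξ i).add ((hJ i).weaken hl (by norm_num))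

/-- The three families of products have orders 3+1, 2+2 and 1+3. -/
theorem ord_defect (h : IsRegular σ) (hl : lam =O[⊤] fun _ => (1 : ℝ))
    (ha : (fun p => a p - a' p) =O[⊤] om) (hξ : OrdIncr lam om ξ ξ')
    (hg : ∀ p, (ξ p).IsGeometric) (hg' : ∀ p, (ξ' p).IsGeometric)
    (hη : OrdIncr lam om η η')
    (hJ : ∀ i, Ord lam om 3 (fun p => J p i) (fun p => J' p i)) (i : Fin l) :
    Ord lam om 4
      (fun p => defect σ (ξ p) (η p) (a p) (a p + (euler σ (ξ p) (a p) + J p)) i)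
      (fun p => defect σ (ξ' p) (η' p) (a' p) (a' p + (euler σ (ξ' p) (a' p) + J' p)) i) := by
  refine ((Ord.sum _ fun j _ => ?_).add (Ord.sum _ fun j _ => Ord.sum _ fun k _ => ?_)).add
    (Ord.sum _ fun j _ => Ord.sum _ fun k₁ _ => Ord.sum _ fun k₂ _ => ?_)
  · exact (ord_rem0 h hl ha hξ hg hg' hJ _).mul (hη.x1 j)
  · exact (ord_rem1 h hl ha hξ hJ _ _).mul (hη.x2 _)
  · exact (ord_rem2 h hl ha hξ hJ _ _ _).mul (hη.x3 _)

end OrderRemainders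

/-! ### Hölder norms and pointwise bounds -/

section Norms

variable {T : ℝ} {V : Type} [NormedAddCommGroup V]

theorem norm2_le_of_bound {μ C : ℝ} {f : Time T → Time T → V}
    (h : ∀ s t, ‖f s t‖ ≤ C * |(t : ℝ) - s| ^ μ) : norm2 μ f ≤ ENNReal.ofReal C := by
  refine iSup₂_le fun s t => ENNReal.div_le_of_le_mul ?_
  rw [← ENNReal.ofReal_mul' (Real.rpow_nonneg (abs_nonneg _) _), ← ofReal_norm]
  exact ENNReal.ofReal_le_ofReal (h s t)

/-- The convention c / 0 = ∞ for c ≠ 0 makes the pointwise bound valid on the diagonal too, without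
a separate hypothesis there. -/
theorem norm_le_of_norm2_le {μ C : ℝ} (hC : 0 ≤ C) {f : Time T → Time T → V}
    (h : norm2 μ f ≤ ENNReal.ofReal C) (s t : Time T) : ‖f s t‖ ≤ C * |(t : ℝ) - s| ^ μ := by
  have h1 : ‖f s t‖ₑ / ENNReal.ofReal (|(t : ℝ) - s| ^ μ) ≤ ENNReal.ofReal C :=
    (le_iSup₂ (f := fun s t : Time T =>
      ‖f s t‖ₑ / ENNReal.ofReal (|(t : ℝ) - (s : ℝ)| ^ μ)) s t).trans h
  have h2 := (ENNReal.div_le_iff_le_mul (Or.inr ENNReal.ofReal_ne_top)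
    (Or.inl ENNReal.ofReal_ne_top)).1 h1
  rw [← ENNReal.ofReal_mul hC, ← ofReal_norm] at h2
  exact (ENNReal.ofReal_le_ofReal_iff
    (mul_nonneg hC (Real.rpow_nonneg (abs_nonneg _) _))).1 h2

theorem memC2_of_bound {μ ν C : ℝ} (hμ : 0 < μ) (hμν : μ ≤ ν) {f : Time T → Time T → V}
    (h : ∀ s t, ‖f s t‖ ≤ C * |(t : ℝ) - s| ^ ν) : MemC2 μ f := by
  have hν : 0 < ν := hμ.trans_le hμν
  refine ⟨fun s => ?_, ?_⟩
  · have := h s s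
    rw [sub_self, abs_zero, Real.zero_rpow hν.ne', mul_zero] at this
    exact norm_le_zero_iff.1 this
  · have hT : ∀ s t : Time T, |(t : ℝ) - s| ≤ T := fun s t => by
      rw [abs_le]
      constructor <;> linarith [s.2.1, s.2.2, t.2.1, t.2.2]
    refine (norm2_le_of_bound (C := |C| * T ^ (ν - μ)) fun s t => (h s t).trans ?_).trans_lt
      ENNReal.ofReal_lt_top
    have h0 : (0 : ℝ) ≤ |(t : ℝ) - s| := abs_nonneg _
    have e : |(t : ℝ) - s| ^ ν = |(t : ℝ) - s| ^ (ν - μ) * |(t : ℝ) - s| ^ μ := by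
      rw [← Real.rpow_add_of_nonneg h0 (by linarith) hμ.le]
      ring_nf
    rw [e, ← mul_assoc]
    refine mul_le_mul_of_nonneg_right ?_ (Real.rpow_nonneg h0 _)
    exact mul_le_mul (le_abs_self C) (Real.rpow_le_rpow h0 (hT s t) (by linarith))
      (Real.rpow_nonneg h0 _) (abs_nonneg _)

theorem memC1_of_bound {μ ν C : ℝ} (hμ : 0 < μ) (hμν : μ ≤ ν) {g : Time T → V}
    (h : ∀ s t, ‖g t - g s‖ ≤ C * |(t : ℝ) - s| ^ ν) : MemC1 μ g := by
  have hν : 0 < ν := hμ.trans_le hμν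
  refine ⟨continuous_iff_continuousAt.2 fun s => ?_, (memC2_of_bound hμ hμν h).2⟩
  have h1 : Tendsto (fun t : Time T => C * |(t : ℝ) - s| ^ ν) (nhds s) (nhds 0) := by
    have hc : Continuous fun t : Time T => C * |(t : ℝ) - s| ^ ν :=
      continuous_const.mul ((continuous_subtype_val.sub continuous_const).abs.rpow_const
        fun _ => Or.inr hν.le)
    have := hc.tendsto s
    simpa [Real.zero_rpow hν.ne'] using this
  exact tendsto_iff_norm_sub_tendsto_zero.2
    (squeeze_zero (fun _ => norm_nonneg _) (fun t => h s t) h1)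

end Norms

/-! ### A Gronwall lemma for almost additive functions -/

section Sewing

/-- Absorption of a perturbation of size `A h ^ α` in the halving step. -/
theorem exists_halving_weight {A α : ℝ} (hA : 0 ≤ A) (hα : 0 < α) :
    ∃ c : ℝ, 0 ≤ c ∧ ∀ ν h : ℝ, 0 ≤ h →
      (2 + A * h ^ α) * ((h / 2) ^ ν * Real.exp (c * (h / 2) ^ α)) ≤
        2 ^ (1 - ν) * (h ^ ν * Real.exp (c * h ^ α)) := by
  have h2 : (2 : ℝ) ^ (-α) < 1 := Real.rpow_lt_one_of_one_lt_of_neg one_lt_two (by linarith)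
  -- The constant c solves c(1 - 2^{-α}) = A/2, so that the factor 1 + (A/2) h^α ≤ exp((A/2) h^α) is
  -- exactly what takes exp(c (h/2)^α) to exp(c h^α).
  refine ⟨A / 2 / (1 - 2 ^ (-α)), div_nonneg (by linarith) (by linarith), fun ν h hh => ?_⟩
  set c := A / 2 / (1 - (2 : ℝ) ^ (-α)) with hc
  have hc' : c * (1 - 2 ^ (-α)) = A / 2 := div_mul_cancel₀ _ (by linarith)
  have e1 : ∀ ν : ℝ, (h / 2) ^ ν = h ^ ν * 2 ^ (-ν) := fun ν => by
    rw [Real.div_rpow hh zero_le_two, Real.rpow_neg zero_le_two, div_eq_mul_inv]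
  have e2 : (2 : ℝ) ^ (1 - ν) = 2 * 2 ^ (-ν) := by
    rw [sub_eq_add_neg, Real.rpow_add two_pos, Real.rpow_one]
  have e3 : 2 + A * h ^ α ≤ 2 * Real.exp (A / 2 * h ^ α) := by
    linarith [Real.add_one_le_exp (A / 2 * h ^ α)]
  have e4 : Real.exp (A / 2 * h ^ α) * Real.exp (c * (h / 2) ^ α) = Real.exp (c * h ^ α) := by
    rw [← Real.exp_add, e1, ← hc']
    ring_nf
  calc _ ≤ 2 * Real.exp (A / 2 * h ^ α) * ((h / 2) ^ ν * Real.exp (c * (h / 2) ^ α)) :=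
        mul_le_mul_of_nonneg_right e3 (by positivity)
    _ = 2 * (h / 2) ^ ν * (Real.exp (A / 2 * h ^ α) * Real.exp (c * (h / 2) ^ α)) := by ring
    _ = _ := by rw [e4, e2, e1]; ring

/-- With K(1 - 2^{1-μ}) = B, the function K h^μ exp(c h^α) is a supersolution of the halving
recursion: halving costs the factor 2^{1-μ} < 1, and the remaining part of K pays for the source B
h^μ. -/
theorem halving_majorant {A α μ c : ℝ} (hμ : 1 < μ) (hc0 : 0 ≤ c)
    (hc : ∀ ν h : ℝ, 0 ≤ h → (2 + A * h ^ α) * ((h / 2) ^ ν * Real.exp (c * (h / 2) ^ α)) ≤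
        2 ^ (1 - ν) * (h ^ ν * Real.exp (c * h ^ α))) {B h : ℝ} (hB : 0 ≤ B) (hh : 0 ≤ h) :
    (2 + A * h ^ α) * (B / (1 - 2 ^ (1 - μ)) * ((h / 2) ^ μ * Real.exp (c * (h / 2) ^ α)))
      + B * h ^ μ ≤ B / (1 - 2 ^ (1 - μ)) * (h ^ μ * Real.exp (c * h ^ α)) := by
  have h2 : (2 : ℝ) ^ (1 - μ) < 1 := Real.rpow_lt_one_of_one_lt_of_neg one_lt_two (by linarith)
  set K := B / (1 - (2 : ℝ) ^ (1 - μ)) with hK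
  have hK0 : 0 ≤ K := div_nonneg hB (by linarith)
  have hK' : K * (1 - 2 ^ (1 - μ)) = B := div_mul_cancel₀ _ (by linarith)
  have h3 := mul_le_mul_of_nonneg_left (hc μ h hh) hK0
  have h4 : B * h ^ μ ≤ B * (h ^ μ * Real.exp (c * h ^ α)) := by
    refine mul_le_mul_of_nonneg_left (le_mul_of_one_le_right (by positivity) ?_) hB
    exact Real.one_le_exp (by positivity)
  nth_rw 2 [← hK'] at h4
  linarith

variable {T : ℝ}

/-- The midpoint of two times. -/
noncomputable def mid (s t : Time T) : Time T :=
  ⟨((s : ℝ) + t) / 2, by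
    constructor <;> linarith [s.2.1, s.2.2, t.2.1, t.2.2]⟩

theorem abs_mid_sub_left (s t : Time T) : |(mid s t : ℝ) - s| = |(t : ℝ) - s| / 2 := by
  have : (mid s t : ℝ) - s = ((t : ℝ) - s) / 2 := by simp only [mid]; ring
  rw [this, abs_div, abs_two]

theorem abs_sub_mid_right (s t : Time T) : |(t : ℝ) - mid s t| = |(t : ℝ) - s| / 2 := by
  have : (t : ℝ) - mid s t = ((t : ℝ) - s) / 2 := by simp only [mid]; ring
  rw [this, abs_div, abs_two]

theorem abs_sub_le (s t : Time T) : |(t : ℝ) - s| ≤ T := by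
  rw [abs_le]
  constructor <;> linarith [s.2.1, s.2.2, t.2.1, t.2.2]

/-- Iterating the midpoint inequality compares g with the supersolution of `halving_majorant`. The a
priori bound with ν > 1 only makes the contribution of the smallest scale vanish, so K depends
neither on it nor on S; S is kept general in order to work on an initial interval. -/
theorem sewing_gronwall (T : ℝ) {A α μ : ℝ} (hA : 0 ≤ A) (hα : 0 < α) (hμ : 1 < μ) :
    ∃ K : ℝ, 0 ≤ K ∧ ∀ (S : Set (Time T)) (_ : ∀ s ∈ S, ∀ t ∈ S, mid s t ∈ S)
      (g : Time T → Time T → ℝ) (B C ν : ℝ), 0 ≤ B → 1 < ν →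
      (∀ s ∈ S, ∀ t ∈ S, g s t ≤ (1 + A * |(t : ℝ) - s| ^ α) * g s (mid s t)
        + g (mid s t) t + B * |(t : ℝ) - s| ^ μ) →
      (∀ s ∈ S, ∀ t ∈ S, g s t ≤ C * |(t : ℝ) - s| ^ ν) →
      ∀ s ∈ S, ∀ t ∈ S, g s t ≤ K * B * |(t : ℝ) - s| ^ μ := by
  obtain ⟨c, hc0, hc⟩ := exists_halving_weight hA hα
  have h2 : (2 : ℝ) ^ (1 - μ) < 1 := Real.rpow_lt_one_of_one_lt_of_neg one_lt_two (by linarith)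
  refine ⟨Real.exp (c * |T| ^ α) / (1 - 2 ^ (1 - μ)),
    div_nonneg (Real.exp_pos _).le (by linarith), fun S hS g B C ν hB hν hg hgC => ?_⟩
  -- After n halvings the a priori bound survives only with the factor (2^{1-ν})^n, which tends to
  -- 0.
  have key : ∀ n : ℕ, ∀ s ∈ S, ∀ t ∈ S, g s t ≤
      B / (1 - 2 ^ (1 - μ)) * (|(t : ℝ) - s| ^ μ * Real.exp (c * |(t : ℝ) - s| ^ α))
      + |C| * (2 ^ (1 - ν)) ^ n * (|(t : ℝ) - s| ^ ν * Real.exp (c * |(t : ℝ) - s| ^ α)) := by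
    intro n
    induction n with
    | zero =>
      intro s hs t ht
      refine (hgC s hs t ht).trans ?_
      have h3 : C * |(t : ℝ) - s| ^ ν ≤
          |C| * (|(t : ℝ) - s| ^ ν * Real.exp (c * |(t : ℝ) - s| ^ α)) := by
        refine (mul_le_mul_of_nonneg_right (le_abs_self C) (by positivity)).trans
          (mul_le_mul_of_nonneg_left (le_mul_of_one_le_right (by positivity) ?_) (abs_nonneg C))
        exact Real.one_le_exp (by positivity)
      have h4 : 0 ≤ B / (1 - 2 ^ (1 - μ)) *
          (|(t : ℝ) - s| ^ μ * Real.exp (c * |(t : ℝ) - s| ^ α)) :=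
        mul_nonneg (div_nonneg hB (by linarith)) (by positivity)
      rw [pow_zero, mul_one]
      linarith
    | succ n ih =>
      intro s hs t ht
      have i1 := ih s hs _ (hS s hs t ht)
      have i2 := ih _ (hS s hs t ht) t ht
      rw [abs_mid_sub_left] at i1
      rw [abs_sub_mid_right] at i2
      have h0 : 0 ≤ |(t : ℝ) - s| := abs_nonneg _
      set h := |(t : ℝ) - s|
      have j1 := halving_majorant hμ hc0 hc hB h0
      have j2 := mul_le_mul_of_nonneg_left (hc ν h h0)
        (show 0 ≤ |C| * ((2 : ℝ) ^ (1 - ν)) ^ n by positivity)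
      have j3 := mul_le_mul_of_nonneg_left i1 (show 0 ≤ 1 + A * h ^ α by positivity)
      rw [pow_succ]
      have := hg s hs t ht
      linarith
  intro s hs t ht
  have hθ : (2 : ℝ) ^ (1 - ν) < 1 :=
    Real.rpow_lt_one_of_one_lt_of_neg one_lt_two (by linarith)
  have hl := (((tendsto_pow_atTop_nhds_zero_of_lt_one (by positivity) hθ).const_mul |C|).mul_const
    (|(t : ℝ) - s| ^ ν * Real.exp (c * |(t : ℝ) - s| ^ α))).const_add
    (B / (1 - 2 ^ (1 - μ)) * (|(t : ℝ) - s| ^ μ * Real.exp (c * |(t : ℝ) - s| ^ α)))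
  have h3 := ge_of_tendsto' hl fun n => key n s hs t ht
  rw [mul_zero, zero_mul, add_zero] at h3
  refine h3.trans ?_
  have h4 : Real.exp (c * |(t : ℝ) - s| ^ α) ≤ Real.exp (c * |T| ^ α) :=
    Real.exp_le_exp.2 (mul_le_mul_of_nonneg_left (Real.rpow_le_rpow (abs_nonneg _)
      ((abs_sub_le s t).trans (le_abs_self T)) hα.le) hc0)
  calc _ ≤ B / (1 - 2 ^ (1 - μ)) * (|(t : ℝ) - s| ^ μ * Real.exp (c * |T| ^ α)) :=
        mul_le_mul_of_nonneg_left (mul_le_mul_of_nonneg_left h4 (by positivity))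
          (div_nonneg hB (by linarith))
    _ = _ := by ring

end Sewing

/-! ### Uniform estimates for the Euler increments -/

section Estimates

variable {l d : ℕ} {σ : Vec (Fin l) → Vec (Fin l × Fin d)}

instance : Sub (Incr d) := ⟨fun ξ ξ' => ⟨ξ.x1 - ξ'.x1, ξ.x2 - ξ'.x2, ξ.x3 - ξ'.x3⟩⟩

/-- The components of `ξ` are at most `M lam`, `M lam ^ 2` and `M lam ^ 3`. -/
structure Incr.BoundedBy (ξ : Incr d) (M lam : ℝ) : Prop where
  x1 : ‖ξ.x1‖ ≤ M * lam
  x2 : ‖ξ.x2‖ ≤ M * lam ^ 2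
  x3 : ‖ξ.x3‖ ≤ M * lam ^ 3

theorem Incr.BoundedBy.mono {ξ : Incr d} {M M' lam lam' : ℝ} (h : ξ.BoundedBy M lam)
    (hM : 0 ≤ M) (hM' : M ≤ M') (hl : 0 ≤ lam) (hl' : lam ≤ lam') : ξ.BoundedBy M' lam' where
  x1 := h.x1.trans (mul_le_mul hM' hl' hl (hM.trans hM'))
  x2 := h.x2.trans (mul_le_mul hM' (pow_le_pow_left₀ hl hl' 2) (by positivity) (hM.trans hM'))
  x3 := h.x3.trans (mul_le_mul hM' (pow_le_pow_left₀ hl hl' 3) (by positivity) (hM.trans hM'))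

/-- Two Euler steps driven by two drivers over two consecutive intervals, with the
quantities that bound them. -/
structure Scenario (l d : ℕ) (M Λ : ℝ) where
  lam : ℝ
  om : ℝ
  ξ : Incr d
  ξ' : Incr d
  η : Incr d
  η' : Incr d
  a : Vec (Fin l)
  a' : Vec (Fin l)
  J : Vec (Fin l)
  J' : Vec (Fin l)
  lam_nonneg : 0 ≤ lam
  lam_le : lam ≤ Λ
  om_nonneg : 0 ≤ om
  bξ : ξ.BoundedBy M lam
  bξ' : ξ'.BoundedBy M lam
  bη : η.BoundedBy M lam
  bη' : η'.BoundedBy M lam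
  dξ : (ξ - ξ').BoundedBy om lam
  dη : (η - η').BoundedBy om lam
  gξ : ξ.IsGeometric
  gξ' : ξ'.IsGeometric
  da : ‖a - a'‖ ≤ om
  bJ : ‖J‖ ≤ M * lam ^ 3
  bJ' : ‖J'‖ ≤ M * lam ^ 3
  dJ : ‖J - J'‖ ≤ lam ^ 3 * om

variable {M Λ : ℝ}

theorem ord_of_bound {P : Type*} {lam om : P → ℝ} {k : ℕ} {ι : Type} [Fintype ι]
    {f f' : P → Vec ι} (hl : ∀ p, 0 ≤ lam p) (ho : ∀ p, 0 ≤ om p)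
    (hf : ∀ p, ‖f p‖ ≤ M * lam p ^ k) (hf' : ∀ p, ‖f' p‖ ≤ M * lam p ^ k)
    (hd : ∀ p, ‖f p - f' p‖ ≤ lam p ^ k * om p) (i : ι) :
    Ord lam om k (fun p => f p i) (fun p => f' p i) where
  left := isBigO_top.2 ⟨M, fun p => by
    rw [Real.norm_of_nonneg (pow_nonneg (hl p) k)]
    exact (PiLp.norm_apply_le (f p) i).trans (hf p)⟩
  right := isBigO_top.2 ⟨M, fun p => by
    rw [Real.norm_of_nonneg (pow_nonneg (hl p) k)]
    exact (PiLp.norm_apply_le (f' p) i).trans (hf' p)⟩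
  diff := isBigO_top.2 ⟨1, fun p => by
    rw [Real.norm_of_nonneg (mul_nonneg (pow_nonneg (hl p) k) (ho p)), one_mul]
    exact (PiLp.norm_apply_le (f p - f' p) i).trans (hd p)⟩

theorem ordIncr_of_bound {P : Type*} {lam om : P → ℝ} {ξ ξ' : P → Incr d}
    (hl : ∀ p, 0 ≤ lam p) (ho : ∀ p, 0 ≤ om p) (hξ : ∀ p, (ξ p).BoundedBy M (lam p))
    (hξ' : ∀ p, (ξ' p).BoundedBy M (lam p))
    (hd : ∀ p, (ξ p - ξ' p).BoundedBy (om p) (lam p)) : OrdIncr lam om ξ ξ' where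
  x1 := ord_of_bound hl ho (fun p => by simpa using (hξ p).x1)
    (fun p => by simpa using (hξ' p).x1) fun p => by
      rw [pow_one, mul_comm]
      exact (hd p).x1
  x2 := ord_of_bound hl ho (fun p => (hξ p).x2) (fun p => (hξ' p).x2) fun p => by
    rw [mul_comm]
    exact (hd p).x2
  x3 := ord_of_bound hl ho (fun p => (hξ p).x3) (fun p => (hξ' p).x3) fun p => by
    rw [mul_comm]
    exact (hd p).x3

/-- For the filter ⊤, being O of something is a bound with one constant for all parameters; this
turns orders back into explicit uniform constants. -/
theorem exists_bound_of_ord {P : Type*} {lam om : P → ℝ} {k : ℕ} {ι : Type} [Fintype ι]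
    [DecidableEq ι]
    {f f' : P → Vec ι} (hl : ∀ p, 0 ≤ lam p) (ho : ∀ p, 0 ≤ om p)
    (h : ∀ i, Ord lam om k (fun p => f p i) (fun p => f' p i)) :
    ∃ C : ℝ, 0 ≤ C ∧ ∀ p, ‖f p‖ ≤ C * lam p ^ k ∧ ‖f p - f' p‖ ≤ C * (lam p ^ k * om p) := by
  obtain ⟨C, hC⟩ := isBigO_top.1 (isBigO_of_coord fun i => (h i).left)
  obtain ⟨D, hD⟩ := isBigO_top.1
    (isBigO_of_coord (f := fun p => f p - f' p) fun i => (h i).diff)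
  refine ⟨max 0 (max C D), le_max_left _ _, fun p => ?_⟩
  have h1 : 0 ≤ lam p ^ k := pow_nonneg (hl p) k
  have h2 : 0 ≤ lam p ^ k * om p := mul_nonneg h1 (ho p)
  have hC' := hC p
  have hD' := hD p
  rw [Real.norm_of_nonneg h1] at hC'
  rw [Real.norm_of_nonneg h2] at hD'
  exact ⟨hC'.trans (mul_le_mul_of_nonneg_right (by simp) h1),
    hD'.trans (mul_le_mul_of_nonneg_right (by simp) h2)⟩

theorem Scenario.isBigO_lam : (fun S : Scenario l d M Λ => S.lam) =O[⊤] fun _ => (1 : ℝ) :=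
  isBigO_top.2 ⟨Λ, fun S => by simpa [abs_of_nonneg S.lam_nonneg] using S.lam_le⟩

theorem Scenario.isBigO_sub : (fun S : Scenario l d M Λ => S.a - S.a') =O[⊤] fun S => S.om :=
  isBigO_top.2 ⟨1, fun S => by simpa [abs_of_nonneg S.om_nonneg] using S.da⟩

theorem Scenario.ordIncr_left : OrdIncr (fun S : Scenario l d M Λ => S.lam) (fun S => S.om)
    (fun S => S.ξ) fun S => S.ξ' :=
  ordIncr_of_bound (fun S => S.lam_nonneg) (fun S => S.om_nonneg) (fun S => S.bξ)
    (fun S => S.bξ') fun S => S.dξ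

theorem Scenario.ordIncr_right : OrdIncr (fun S : Scenario l d M Λ => S.lam) (fun S => S.om)
    (fun S => S.η) fun S => S.η' :=
  ordIncr_of_bound (fun S => S.lam_nonneg) (fun S => S.om_nonneg) (fun S => S.bη)
    (fun S => S.bη') fun S => S.dη

/-- The parameter space is the type of all scenarios with given M and Λ, so one constant serves all
drivers, initial points and intervals. -/
theorem exists_euler_bound (h : IsRegular σ) (M Λ : ℝ) :
    ∃ C : ℝ, 0 ≤ C ∧ ∀ S : Scenario l d M Λ, ‖euler σ S.ξ S.a‖ ≤ C * S.lam ∧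
      ‖euler σ S.ξ S.a - euler σ S.ξ' S.a'‖ ≤ C * (S.lam * S.om) := by
  have := exists_bound_of_ord (fun S : Scenario l d M Λ => S.lam_nonneg)
    (fun S => S.om_nonneg) fun i =>
      ord_euler h Scenario.isBigO_lam Scenario.isBigO_sub Scenario.ordIncr_left i
  simpa only [pow_one] using this

theorem exists_defect_bound (h : IsRegular σ) (M Λ : ℝ) :
    ∃ C : ℝ, 0 ≤ C ∧ ∀ S : Scenario l d M Λ,
      ‖defect σ S.ξ S.η S.a (S.a + (euler σ S.ξ S.a + S.J))‖ ≤ C * S.lam ^ 4 ∧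
      ‖defect σ S.ξ S.η S.a (S.a + (euler σ S.ξ S.a + S.J)) -
        defect σ S.ξ' S.η' S.a' (S.a' + (euler σ S.ξ' S.a' + S.J'))‖ ≤
          C * (S.lam ^ 4 * S.om) :=
  exists_bound_of_ord (fun S : Scenario l d M Λ => S.lam_nonneg)
    (fun S => S.om_nonneg) fun i =>
      ord_defect h Scenario.isBigO_lam Scenario.isBigO_sub Scenario.ordIncr_left
        (fun S => S.gξ) (fun S => S.gξ') Scenario.ordIncr_right
        (ord_of_bound (fun S => S.lam_nonneg) (fun S => S.om_nonneg) (fun S => S.bJ)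
          (fun S => S.bJ') fun S => S.dJ) i

theorem Incr.boundedBy_sub_self (ξ : Incr d) {M lam : ℝ} (hM : 0 ≤ M) (hl : 0 ≤ lam) :
    (ξ - ξ).BoundedBy M lam where
  x1 := by
    change ‖ξ.x1 - ξ.x1‖ ≤ _
    rw [sub_self, norm_zero]
    positivity
  x2 := by
    change ‖ξ.x2 - ξ.x2‖ ≤ _
    rw [sub_self, norm_zero]
    positivity
  x3 := by
    change ‖ξ.x3 - ξ.x3‖ ≤ _
    rw [sub_self, norm_zero]
    positivity

/-- The end point of the first step enters the defect only through the coefficients multiplying η,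
which form the second Euler increment. -/
theorem defect_sub_defect (ξ η : Incr d) (a b c : Vec (Fin l)) :
    defect σ ξ η a b - defect σ ξ η a c = euler σ η b - euler σ η c := by
  ext i
  simp only [defect, euler, rem0, rem1, PiLp.sub_apply, sub_mul, Finset.sum_sub_distrib]
  ring

theorem exists_euler_bound_single (h : IsRegular σ) {M Λ : ℝ} (hM : 0 ≤ M) :
    ∃ C : ℝ, 0 ≤ C ∧ ∀ lam : ℝ, 0 ≤ lam → lam ≤ Λ → ∀ ξ : Incr d, ξ.BoundedBy M lam →
      ξ.IsGeometric → ∀ a b : Vec (Fin l), ‖euler σ ξ a‖ ≤ C * lam ∧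
        ‖euler σ ξ a - euler σ ξ b‖ ≤ C * (lam * ‖a - b‖) := by
  obtain ⟨C, hC0, hC⟩ := exists_euler_bound h M Λ
  exact ⟨C, hC0, fun lam h0 h1 ξ hξ hg a b => hC ⟨lam, ‖a - b‖, ξ, ξ, ξ, ξ, a, b, 0, 0, h0, h1,
    norm_nonneg _, hξ, hξ, hξ, hξ, ξ.boundedBy_sub_self (norm_nonneg _) h0,
    ξ.boundedBy_sub_self (norm_nonneg _) h0, hg, hg, le_rfl,
    by rw [norm_zero]; positivity, by rw [norm_zero]; positivity,
    by rw [sub_zero, norm_zero]; positivity⟩⟩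

/-- The defect of additivity, in terms of the error of one Euler step. -/
theorem exists_defect_bound_single (h : IsRegular σ) {M Λ : ℝ} (hM : 0 ≤ M) :
    ∃ C : ℝ, 0 ≤ C ∧ ∀ lam : ℝ, 0 ≤ lam → lam ≤ Λ → ∀ ξ η : Incr d, ξ.BoundedBy M lam →
      η.BoundedBy M lam → ξ.IsGeometric → η.IsGeometric → ∀ a b : Vec (Fin l),
        ‖defect σ ξ η a b‖ ≤ C * (lam * ‖b - a - euler σ ξ a‖ + lam ^ 4) := by
  obtain ⟨C, hC0, hC⟩ := exists_defect_bound h M Λ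
  obtain ⟨D, hD0, hD⟩ := exists_euler_bound_single h (Λ := Λ) hM
  refine ⟨C + D, by positivity, fun lam h0 h1 ξ η hξ hη hg hg' a b => ?_⟩
  -- First the case where the second step starts at the exact Euler point (J = 0, equal drivers, om
  -- = 0); moving this point to b changes the defect by a difference of Euler increments, which is
  -- Lipschitz in the point with constant D lam.
  have i1 := (hC ⟨lam, 0, ξ, ξ, η, η, a, a, 0, 0, h0, h1, le_rfl, hξ, hξ, hη, hη,
    ξ.boundedBy_sub_self le_rfl h0, η.boundedBy_sub_self le_rfl h0, hg, hg, by simp,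
    by rw [norm_zero]; positivity, by rw [norm_zero]; positivity, by simp⟩).1
  have i2 := (hD lam h0 h1 η hη hg' b (a + (euler σ ξ a + 0))).2
  rw [← defect_sub_defect ξ η a] at i2
  have e : b - (a + (euler σ ξ a + 0)) = b - a - euler σ ξ a := by
    rw [add_zero]; abel
  rw [e] at i2
  have i3 := norm_add_le (defect σ ξ η a b - defect σ ξ η a (a + (euler σ ξ a + 0)))
    (defect σ ξ η a (a + (euler σ ξ a + 0)))
  rw [sub_add_cancel] at i3
  have i4 : 0 ≤ C * (lam * ‖b - a - euler σ ξ a‖) := by positivity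
  have i5 : 0 ≤ D * lam ^ 4 := by positivity
  simp only at i1
  linarith

end Estimates

/-! ### Increments of drivers -/

section Drivers

variable {T : ℝ} {l d : ℕ} {σ : Vec (Fin l) → Vec (Fin l × Fin d)} {X X' : Driver T d} {γ : ℝ}

theorem rpow_pow_eq {h : ℝ} (hh : 0 ≤ h) (γ : ℝ) (n : ℕ) : (h ^ γ) ^ n = h ^ ((n : ℝ) * γ) := by
  rw [mul_comm, Real.rpow_mul_natCast hh]

theorem inc_boundedBy {M : ℝ} (hM : 0 ≤ M) (h1 : norm1 γ X.x ≤ ENNReal.ofReal M)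
    (h2 : norm2 (2 * γ) X.x2 ≤ ENNReal.ofReal M) (h3 : norm2 (3 * γ) X.x3 ≤ ENNReal.ofReal M)
    (s t : Time T) : (X.inc s t).BoundedBy M (|(t : ℝ) - s| ^ γ) where
  x1 := norm_le_of_norm2_le hM h1 s t
  x2 := by
    rw [rpow_pow_eq (abs_nonneg _)]
    exact_mod_cast norm_le_of_norm2_le hM h2 s t
  x3 := by
    rw [rpow_pow_eq (abs_nonneg _)]
    exact_mod_cast norm_le_of_norm2_le hM h3 s t

theorem inc_boundedBy_of_size {M : ℝ≥0} (h : X.size γ ≤ M) (s t : Time T) :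
    (X.inc s t).BoundedBy M (|(t : ℝ) - s| ^ γ) := by
  have hM : ENNReal.ofReal M = M := ENNReal.ofReal_coe_nnreal
  refine inc_boundedBy M.coe_nonneg ?_ ?_ ?_ s t <;> rw [hM] <;> refine le_trans ?_ h
  · exact le_add_right le_self_add
  · exact le_add_right le_add_self
  · exact le_add_self

theorem Driver.IsRough.size_le (hX : X.IsRough γ) : X.size γ ≤ (X.size γ).toNNReal :=
  (ENNReal.coe_toNNReal (ENNReal.add_ne_top.2
    ⟨ENNReal.add_ne_top.2 ⟨hX.mem_x.2.ne, hX.mem_x2.2.ne⟩, hX.mem_x3.2.ne⟩)).ge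

theorem inc_sub_boundedBy {M : ℝ} (hM : 0 ≤ M)
    (h1 : norm1 γ (fun t => X.x t - X'.x t) ≤ ENNReal.ofReal M)
    (h2 : norm2 (2 * γ) (fun s t => X.x2 s t - X'.x2 s t) ≤ ENNReal.ofReal M)
    (h3 : norm2 (3 * γ) (fun s t => X.x3 s t - X'.x3 s t) ≤ ENNReal.ofReal M)
    (s t : Time T) : (X.inc s t - X'.inc s t).BoundedBy M (|(t : ℝ) - s| ^ γ) where
  x1 := by
    have := norm_le_of_norm2_le hM h1 s t
    have e : delta1 (fun t => X.x t - X'.x t) s t = delta1 X.x s t - delta1 X'.x s t := by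
      simp only [delta1]
      abel
    rwa [e] at this
  x2 := by
    rw [rpow_pow_eq (abs_nonneg _)]
    exact_mod_cast norm_le_of_norm2_le hM h2 s t
  x3 := by
    rw [rpow_pow_eq (abs_nonneg _)]
    exact_mod_cast norm_le_of_norm2_le hM h3 s t

theorem chen2_apply (hX : X.IsRough γ) (s u t : Time T) (i j : Fin d) :
    X.x2 s t (i, j) = X.x2 s u (i, j) + X.x2 u t (i, j) + delta1 X.x s u i * delta1 X.x u t j := by
  have := hX.chen2 s u t i j
  simp only [delta2, PiLp.sub_apply] at this
  linarith

theorem chen3_apply (hX : X.IsRough γ) (s u t : Time T) (i j k : Fin d) :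
    X.x3 s t (i, j, k) = X.x3 s u (i, j, k) + X.x3 u t (i, j, k)
      + X.x2 s u (i, j) * delta1 X.x u t k + delta1 X.x s u i * X.x2 u t (j, k) := by
  have := hX.chen3 s u t i j k
  simp only [delta2, PiLp.sub_apply] at this
  linarith

/-- The relation is assumed for s < t only. Chen's relation over s, t, s, where the area from s to s
vanishes, transfers it to reversed times. -/
theorem inc_isGeometric (hX : X.IsRough γ) (hg : X.IsGeometric) (s t : Time T) :
    (X.inc s t).IsGeometric := by
  intro i j
  change X.x2 s t (i, j) + X.x2 s t (j, i) = delta1 X.x s t i * delta1 X.x s t j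
  rcases lt_trichotomy s t with h | rfl | h
  · linarith [hg s t h i j]
  · simp [hX.mem_x2.1, delta1]
  · have h1 := hg t s h i j
    have h2 := chen2_apply hX s t s i j
    have h3 := chen2_apply hX s t s j i
    rw [hX.mem_x2.1] at h2 h3
    simp only [delta1, PiLp.sub_apply, PiLp.zero_apply] at *
    linarith

/-- The products created by Chen's relations are precisely the Taylor terms subtracted in `rem0` and
`rem1`. The identity is algebraic and holds for any b, related to a or not. -/
theorem euler_chen (hX : X.IsRough γ) (s u t : Time T) (a b : Vec (Fin l)) :
    euler σ (X.inc s t) a + defect σ (X.inc s u) (X.inc u t) a b =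
      euler σ (X.inc s u) a + euler σ (X.inc u t) b := by
  ext i
  have h1 : ∀ j, delta1 X.x s t j = delta1 X.x s u j + delta1 X.x u t j := fun j => by
    simp only [delta1, PiLp.sub_apply]
    ring
  simp only [euler, defect, rem0, rem1, Driver.inc, PiLp.add_apply, h1, chen2_apply hX s u t,
    chen3_apply hX s u t, sub_mul, mul_add, Finset.sum_sub_distrib, Finset.sum_add_distrib,
    Finset.sum_mul, ← mul_assoc]
  ring

end Drivers

/-! ### Paths close to their Euler expansions -/

section Davie

variable {T : ℝ} {l d : ℕ} {σ : Vec (Fin l) → Vec (Fin l × Fin d)} {X X' : Driver T d} {γ : ℝ}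
  {y y' : Time T → Vec (Fin l)}

/-- The error of the Euler expansion of the path `y`. -/
noncomputable def eulerError (X : Driver T d) (σ : Vec (Fin l) → Vec (Fin l × Fin d))
    (y : Time T → Vec (Fin l)) (s t : Time T) : Vec (Fin l) :=
  y t - y s - euler σ (X.inc s t) (y s)

theorem eulerError_chen (hX : X.IsRough γ) (y : Time T → Vec (Fin l)) (s u t : Time T) :
    eulerError X σ y s t = eulerError X σ y s u + eulerError X σ y u t
      + defect σ (X.inc s u) (X.inc u t) (y s) (y u) := by
  have := euler_chen (σ := σ) hX s u t (y s) (y u)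
  rw [← eq_sub_iff_add_eq'] at this
  rw [this]
  simp only [eulerError]
  abel

theorem half_rpow_le {h γ : ℝ} (hh : 0 ≤ h) (hγ : 0 ≤ γ) : (h / 2) ^ γ ≤ h ^ γ :=
  Real.rpow_le_rpow (by linarith) (by linarith) hγ

theorem boundedBy_left {M : ℝ} (hM : 0 ≤ M) (hγ : 0 ≤ γ) {f : Time T → Time T → Incr d}
    (hb : ∀ s t, (f s t).BoundedBy M (|(t : ℝ) - s| ^ γ)) (s t : Time T) :
    (f s (mid s t)).BoundedBy M (|(t : ℝ) - s| ^ γ) :=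
  (hb s (mid s t)).mono hM le_rfl (Real.rpow_nonneg (abs_nonneg _) _) (by
    rw [abs_mid_sub_left]
    exact half_rpow_le (abs_nonneg _) hγ)

theorem boundedBy_right {M : ℝ} (hM : 0 ≤ M) (hγ : 0 ≤ γ) {f : Time T → Time T → Incr d}
    (hb : ∀ s t, (f s t).BoundedBy M (|(t : ℝ) - s| ^ γ)) (s t : Time T) :
    (f (mid s t) t).BoundedBy M (|(t : ℝ) - s| ^ γ) :=
  (hb (mid s t) t).mono hM le_rfl (Real.rpow_nonneg (abs_nonneg _) _) (by
    rw [abs_sub_mid_right]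
    exact half_rpow_le (abs_nonneg _) hγ)

theorem abs_sub_rpow_le (hγ : 0 ≤ γ) (s t : Time T) : |(t : ℝ) - s| ^ γ ≤ T ^ γ :=
  Real.rpow_le_rpow (abs_nonneg _) (abs_sub_le s t) hγ

/-- A path whose Euler error is `o(|t - s|)` has an error `O(|t - s| ^ (4 γ))`. -/
theorem exists_eulerError_bound (hσ : IsRegular σ) (hγ : 1 / 4 < γ) (M : ℝ≥0) (T : ℝ) :
    ∃ K : ℝ, 0 ≤ K ∧ ∀ (X : Driver T d) (y : Time T → Vec (Fin l)), X.IsRough γ →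
      X.IsGeometric → X.size γ ≤ M → MemC2OnePlus (eulerError X σ y) →
      ∀ s t, ‖eulerError X σ y s t‖ ≤ K * |(t : ℝ) - s| ^ (4 * γ) := by
  have hγ0 : 0 ≤ γ := by linarith
  obtain ⟨C, hC0, hC⟩ := exists_defect_bound_single hσ (Λ := T ^ γ) M.coe_nonneg
  obtain ⟨K, hK0, hK⟩ := sewing_gronwall T hC0 (show 0 < γ by linarith)
    (show 1 < 4 * γ by linarith)
  refine ⟨K * C, by positivity, fun X y hX hg hM ⟨ν, hν, hy⟩ s t => ?_⟩
  obtain ⟨B, hB⟩ := hy.bound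
  refine hK Set.univ (fun _ _ _ _ => trivial) (fun s t => ‖eulerError X σ y s t‖) C B ν hC0 hν
    (fun s _ t _ => ?_) (fun s _ t _ => hB s t) s trivial t trivial
  have hb := inc_boundedBy_of_size hM
  have h1 := hC (|(t : ℝ) - s| ^ γ) (Real.rpow_nonneg (abs_nonneg _) _) (abs_sub_rpow_le hγ0 s t)
    _ _ (boundedBy_left M.coe_nonneg hγ0 hb s t) (boundedBy_right M.coe_nonneg hγ0 hb s t)
    (inc_isGeometric hX hg _ _) (inc_isGeometric hX hg _ _) (y s) (y (mid s t))
  rw [rpow_pow_eq (abs_nonneg _), ← eulerError] at h1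
  rw [eulerError_chen hX y s (mid s t) t]
  refine (norm_add₃_le).trans ?_
  push_cast at h1
  linarith

/-- Stability of the Euler error under perturbation of the driver and of the path. -/
theorem exists_eulerError_sub_bound (hσ : IsRegular σ) (hγ : 1 / 4 < γ) (M : ℝ≥0) {K : ℝ}
    (hK : 0 ≤ K) (hT : 0 ≤ T) :
    ∃ C : ℝ, 0 ≤ C ∧ ∀ (X X' : Driver T d) (y y' : Time T → Vec (Fin l)), X.IsRough γ →
      X.IsGeometric → X'.IsRough γ → X'.IsGeometric → X.size γ ≤ M → X'.size γ ≤ M →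
      (∀ s t, ‖eulerError X σ y s t‖ ≤ K * |(t : ℝ) - s| ^ (4 * γ)) →
      (∀ s t, ‖eulerError X' σ y' s t‖ ≤ K * |(t : ℝ) - s| ^ (4 * γ)) →
      ∀ (ε W : ℝ) (τ : Time T), 0 ≤ ε → 0 ≤ W →
      (∀ s t, (X.inc s t - X'.inc s t).BoundedBy ε (|(t : ℝ) - s| ^ γ)) →
      (∀ s ≤ τ, ‖y s - y' s‖ ≤ W) → ∀ s ≤ τ, ∀ t ≤ τ,
      ‖eulerError X σ y s t - eulerError X' σ y' s t‖ ≤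
        C * (W + ε) * |(t : ℝ) - s| ^ (4 * γ) := by
  have hγ0 : 0 ≤ γ := by linarith
  have hΛ : 0 ≤ T ^ γ := Real.rpow_nonneg hT _
  -- A scenario has a single constant for the drivers, bounded by M, and for J, which is an Euler
  -- error here: K h^{4γ} ≤ K T^γ (h^γ)^3.
  set N : ℝ := M + K * T ^ γ with hN
  have hMN : (M : ℝ) ≤ N := by rw [hN]; linarith [mul_nonneg hK hΛ]
  have hN0 : 0 ≤ N := M.coe_nonneg.trans hMN
  obtain ⟨C, hC0, hC⟩ := exists_defect_bound hσ N (T ^ γ)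
  obtain ⟨G, hG0, hG⟩ := sewing_gronwall T hC0 (show 0 < γ by linarith)
    (show 1 < 4 * γ by linarith)
  refine ⟨G * C, by positivity,
    fun X X' y y' hX hg hX' hg' hM hM' hy hy' ε W τ hε hW hXX hw => ?_⟩
  intro s hs t ht
  rw [mul_assoc G]
  -- The paths are compared up to τ only, and this set is stable under midpoints. The a priori bound
  -- 2K is the sum of the two separate errors; it does not enter the conclusion.
  refine hG (Set.Iic τ) ?_ (fun s t => ‖eulerError X σ y s t - eulerError X' σ y' s t‖)
    (C * (W + ε)) (2 * K) (4 * γ) (by positivity) (by linarith) ?_ ?_ s hs t ht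
  · intro s hs t ht
    have h1 : (s : ℝ) ≤ τ := hs
    have h2 : (t : ℝ) ≤ τ := ht
    change ((s : ℝ) + t) / 2 ≤ τ
    linarith
  · intro s hs t ht
    have hb := inc_boundedBy_of_size hM
    have hb' := inc_boundedBy_of_size hM'
    set h := |(t : ℝ) - s| with hh
    have hh0 : 0 ≤ h := abs_nonneg _
    have hl0 : 0 ≤ h ^ γ := Real.rpow_nonneg hh0 _
    -- For h = 0 both errors vanish; the choice of om below divides by (h^γ)^3.
    rcases hh0.eq_or_lt with h0 | h0
    · have e1 := hy s t
      have e2 := hy' s t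
      rw [← hh, ← h0, Real.zero_rpow (by linarith), mul_zero, norm_le_zero_iff] at e1 e2
      rw [e1, e2, sub_zero, norm_zero]
      positivity
    set u := mid s t
    set D := ‖eulerError X σ y s u - eulerError X' σ y' s u‖ with hD
    have hlpos : 0 < h ^ γ := Real.rpow_pos_of_pos h0 _
    have hlT : h ^ γ ≤ T ^ γ := abs_sub_rpow_le hγ0 s t
    -- The third summand of om is chosen so that lam^3 om dominates the difference D of the errors
    -- on the left half; then C lam^4 om = C(W + ε) h^{4γ} + C h^γ D, the form required by
    -- `sewing_gronwall`.
    have hom : W + ε ≤ W + ε + D / (h ^ γ) ^ 3 := by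
      have : 0 ≤ D / (h ^ γ) ^ 3 := div_nonneg (norm_nonneg _) (by positivity)
      linarith
    have hJ : ∀ J : Vec (Fin l), ‖J‖ ≤ K * |(u : ℝ) - s| ^ (4 * γ) → ‖J‖ ≤ N * (h ^ γ) ^ 3 := by
      intro J hJ
      have i1 : |(u : ℝ) - s| ^ (4 * γ) ≤ (h ^ γ) ^ 4 := by
        rw [abs_mid_sub_left, rpow_pow_eq hh0]
        push_cast
        exact half_rpow_le hh0 (by linarith)
      have i2 : (h ^ γ) ^ 4 ≤ T ^ γ * (h ^ γ) ^ 3 := by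
        rw [pow_succ']
        exact mul_le_mul_of_nonneg_right hlT (by positivity)
      have i3 : K * (T ^ γ * (h ^ γ) ^ 3) ≤ N * (h ^ γ) ^ 3 := by
        rw [← mul_assoc]
        exact mul_le_mul_of_nonneg_right (by rw [hN]; linarith [M.coe_nonneg]) (by positivity)
      exact hJ.trans ((mul_le_mul_of_nonneg_left (i1.trans i2) hK).trans i3)
    have h1 := (hC ⟨h ^ γ, W + ε + D / (h ^ γ) ^ 3, X.inc s u, X'.inc s u, X.inc u t, X'.inc u t,
      y s, y' s, eulerError X σ y s u, eulerError X' σ y' s u, hl0, hlT,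
      by linarith,
      (boundedBy_left M.coe_nonneg hγ0 hb s t).mono M.coe_nonneg hMN hl0 le_rfl,
      (boundedBy_left M.coe_nonneg hγ0 hb' s t).mono M.coe_nonneg hMN hl0 le_rfl,
      (boundedBy_right M.coe_nonneg hγ0 hb s t).mono M.coe_nonneg hMN hl0 le_rfl,
      (boundedBy_right M.coe_nonneg hγ0 hb' s t).mono M.coe_nonneg hMN hl0 le_rfl,
      (boundedBy_left hε hγ0 hXX s t).mono hε (by linarith) hl0 le_rfl,
      (boundedBy_right hε hγ0 hXX s t).mono hε (by linarith) hl0 le_rfl,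
      inc_isGeometric hX hg _ _, inc_isGeometric hX' hg' _ _,
      (hw s hs).trans (by linarith), hJ _ (hy s u), hJ _ (hy' s u), by
        rw [mul_add, mul_div_cancel₀ _ (by positivity)]
        have : 0 ≤ (h ^ γ) ^ 3 * (W + ε) := by positivity
        linarith⟩).2
    have e : ∀ (X : Driver T d) (y : Time T → Vec (Fin l)),
        y s + (euler σ (X.inc s u) (y s) + eulerError X σ y s u) = y u := by
      intro X y
      simp only [eulerError]
      abel
    simp only [e] at h1
    have e2 : C * ((h ^ γ) ^ 4 * (W + ε + D / (h ^ γ) ^ 3)) =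
        C * (W + ε) * h ^ (4 * γ) + C * h ^ γ * D := by
      have : (h ^ γ) ^ 4 = h ^ (4 * γ) := by
        rw [rpow_pow_eq hh0]
        norm_cast
      rw [← this]
      field_simp
    rw [e2] at h1
    rw [eulerError_chen hX y s u t, eulerError_chen hX' y' s u t]
    have e3 : ∀ a b c a' b' c' : Vec (Fin l), a + b + c - (a' + b' + c') =
        (a - a') + (b - b') + (c - c') := by
      intros
      abel
    rw [e3]
    refine (norm_add₃_le).trans ?_
    linarith
  · intro s _ t _
    refine (norm_sub_le _ _).trans ?_
    linarith [hy s t, hy' s t]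

/-- Each increment is an Euler increment plus an error; the differences of both parts are
proportional to W + ε, the second with the larger exponent 4γ. -/
theorem exists_sub_holder_bound (hσ : IsRegular σ) (hγ : 1 / 4 < γ) (M : ℝ≥0) {K : ℝ}
    (hK : 0 ≤ K) (hT : 0 ≤ T) :
    ∃ C : ℝ, 0 ≤ C ∧ ∀ (X X' : Driver T d) (y y' : Time T → Vec (Fin l)), X.IsRough γ →
      X.IsGeometric → X'.IsRough γ → X'.IsGeometric → X.size γ ≤ M → X'.size γ ≤ M →
      (∀ s t, ‖eulerError X σ y s t‖ ≤ K * |(t : ℝ) - s| ^ (4 * γ)) →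
      (∀ s t, ‖eulerError X' σ y' s t‖ ≤ K * |(t : ℝ) - s| ^ (4 * γ)) →
      ∀ (ε W : ℝ) (τ : Time T), 0 ≤ ε → 0 ≤ W →
      (∀ s t, (X.inc s t - X'.inc s t).BoundedBy ε (|(t : ℝ) - s| ^ γ)) →
      (∀ s ≤ τ, ‖y s - y' s‖ ≤ W) → ∀ s ≤ τ, ∀ t ≤ τ,
      ‖(y t - y' t) - (y s - y' s)‖ ≤ C * (W + ε) * |(t : ℝ) - s| ^ γ := by
  have hγ0 : 0 ≤ γ := by linarith
  have hΛ : 0 ≤ T ^ γ := Real.rpow_nonneg hT _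
  obtain ⟨C, hC0, hC⟩ := exists_eulerError_sub_bound (l := l) (d := d) hσ hγ M hK hT
  obtain ⟨D, hD0, hD⟩ := exists_euler_bound hσ M (T ^ γ)
  refine ⟨D + C * (T ^ γ) ^ 3, by positivity,
    fun X X' y y' hX hg hX' hg' hM hM' hy hy' ε W τ hε hW hXX hw s hs t ht => ?_⟩
  have h1 := hC X X' y y' hX hg hX' hg' hM hM' hy hy' ε W τ hε hW hXX hw s hs t ht
  have hb := inc_boundedBy_of_size hM s t
  have hb' := inc_boundedBy_of_size hM' s t
  have hl0 : 0 ≤ |(t : ℝ) - s| ^ γ := Real.rpow_nonneg (abs_nonneg _) _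
  have hlT := abs_sub_rpow_le hγ0 s t
  have h2 := (hD ⟨|(t : ℝ) - s| ^ γ, W + ε, X.inc s t, X'.inc s t, X.inc s t, X'.inc s t,
    y s, y' s, 0, 0, hl0, hlT, by positivity, hb, hb', hb, hb',
    (hXX s t).mono hε (by linarith) hl0 le_rfl, (hXX s t).mono hε (by linarith) hl0 le_rfl,
    inc_isGeometric hX hg _ _, inc_isGeometric hX' hg' _ _, (hw s hs).trans (by linarith),
    by rw [norm_zero]; positivity, by rw [norm_zero]; positivity,
    by rw [sub_zero, norm_zero]; positivity⟩).2
  have e : (y t - y' t) - (y s - y' s) =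
      (euler σ (X.inc s t) (y s) - euler σ (X'.inc s t) (y' s)) +
      (eulerError X σ y s t - eulerError X' σ y' s t) := by
    simp only [eulerError]
    abel
  rw [e]
  refine (norm_add_le _ _).trans ?_
  have h3 : |(t : ℝ) - s| ^ (4 * γ) ≤ (T ^ γ) ^ 3 * |(t : ℝ) - s| ^ γ := by
    have : |(t : ℝ) - s| ^ (4 * γ) = (|(t : ℝ) - s| ^ γ) ^ 3 * |(t : ℝ) - s| ^ γ := by
      rw [← pow_succ, rpow_pow_eq (abs_nonneg _)]
      norm_num
    rw [this]
    exact mul_le_mul_of_nonneg_right (pow_le_pow_left₀ hl0 hlT 3) hl0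
  have h4 := mul_le_mul_of_nonneg_left h3 (show 0 ≤ C * (W + ε) by positivity)
  simp only at h2
  linarith

end Davie

/-! ### Propagation of local estimates -/

/-- On a time step with C (T/n)^γ ≤ 1/2 the supremum of ‖w‖ up to the end of the step appears on
both sides with factor 1/2 and can be absorbed, so ‖w‖ + ε at most doubles per step. The bound B
serves only to make this supremum finite. -/
theorem exists_uniform_bound {V : Type} [NormedAddCommGroup V] {T C γ : ℝ} (hT : 0 < T)
    (hC : 0 ≤ C) (hγ : 0 < γ) :
    ∃ N : ℝ, 0 ≤ N ∧ ∀ (w : Time T → V) (ε B : ℝ), 0 ≤ ε → (∀ s, ‖w s‖ ≤ B) →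
      (∀ (W : ℝ) (τ : Time T), 0 ≤ W → (∀ s ≤ τ, ‖w s‖ ≤ W) → ∀ s ≤ τ, ∀ t ≤ τ,
        ‖w t - w s‖ ≤ C * (W + ε) * |(t : ℝ) - s| ^ γ) →
      ∀ t, ‖w t‖ + ε ≤ N * (‖w ⟨0, le_rfl, hT.le⟩‖ + ε) := by
  obtain ⟨n, hn0, hn⟩ : ∃ n : ℕ, 0 < n ∧ C * (T / n) ^ γ ≤ 1 / 2 := by
    have h1 : Tendsto (fun n : ℕ => C * (T / n) ^ γ) atTop (nhds 0) := by
      have h2 := ((tendsto_const_div_atTop_nhds_zero_nat T).rpow_const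
        (Or.inr hγ.le)).const_mul C
      simpa [Real.zero_rpow hγ.ne'] using h2
    obtain ⟨n, hn, hn'⟩ := ((h1.eventually (gt_mem_nhds (show (0 : ℝ) < 1 / 2 by norm_num))).and
      (eventually_gt_atTop 0)).exists
    exact ⟨n, hn', hn.le⟩
  refine ⟨2 ^ n, by positivity, fun w ε B hε hB hw => ?_⟩
  have hn0' : (0 : ℝ) < n := by exact_mod_cast hn0
  set Q := ‖w ⟨0, le_rfl, hT.le⟩‖ + ε with hQ
  have key : ∀ k : ℕ, k ≤ n → ∀ t : Time T, (t : ℝ) ≤ k * (T / n) → ‖w t‖ + ε ≤ 2 ^ k * Q := by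
    intro k
    induction k with
    | zero =>
      intro _ t ht
      have : t = ⟨0, le_rfl, hT.le⟩ := Subtype.ext (le_antisymm (by simpa using ht) t.2.1)
      rw [this]
      simp [hQ]
    | succ k ih =>
      intro hk t ht
      have ih := ih (by omega)
      have hkn : ∀ j : ℕ, j ≤ n → (j : ℝ) * (T / n) ∈ Set.Icc 0 T := by
        intro j hj
        refine ⟨by positivity, ?_⟩
        rw [mul_div_assoc', div_le_iff₀ hn0', mul_comm]
        exact mul_le_mul_of_nonneg_left (by exact_mod_cast hj) hT.le
      let τ : Time T := ⟨k * (T / n), hkn k (by omega)⟩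
      let τ' : Time T := ⟨(k + 1 : ℕ) * (T / n), hkn (k + 1) hk⟩
      have hbdd : BddAbove (Set.range fun s : Set.Iic τ' => ‖w s‖) :=
        ⟨B, by rintro _ ⟨s, rfl⟩; exact hB s⟩
      set W := ⨆ s : Set.Iic τ', ‖w s‖ with hW
      have hsW : ∀ s ≤ τ', ‖w s‖ ≤ W := fun s hs => le_ciSup hbdd ⟨s, hs⟩
      have hW0 : 0 ≤ W := (norm_nonneg _).trans (hsW τ' le_rfl)
      have hττ' : τ ≤ τ' := by
        change (k : ℝ) * (T / n) ≤ (k + 1 : ℕ) * (T / n)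
        push_cast
        have : 0 < T / n := by positivity
        linarith
      -- Solving for W gives W + ε ≤ 2^{k+1} Q.
      have hle : W ≤ (2 ^ k * Q - ε) + 1 / 2 * (W + ε) := by
        have : Nonempty (Set.Iic τ') := ⟨⟨τ', Set.mem_Iic.2 le_rfl⟩⟩
        refine ciSup_le fun s => ?_
        rcases le_total (s : Time T) τ with hs | hs
        · have := ih s hs
          linarith
        · have h1 := ih τ le_rfl
          have h2 := hw W τ' hW0 hsW τ hττ' s s.2
          have h3 : |((s : Time T) : ℝ) - τ| ^ γ ≤ (T / n) ^ γ := by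
            refine Real.rpow_le_rpow (abs_nonneg _) ?_ hγ.le
            have h4 : (τ : ℝ) ≤ ((s : Time T) : ℝ) := hs
            have h5 : ((s : Time T) : ℝ) ≤ (k + 1 : ℕ) * (T / n) := s.2
            rw [abs_of_nonneg (by linarith)]
            push_cast at h5
            simp only [τ]
            linarith
          have h4 : C * (W + ε) * |((s : Time T) : ℝ) - τ| ^ γ ≤ 1 / 2 * (W + ε) := by
            calc _ ≤ C * (W + ε) * (T / n) ^ γ :=
                  mul_le_mul_of_nonneg_left h3 (by positivity)
              _ = C * (T / n) ^ γ * (W + ε) := by ring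
              _ ≤ _ := mul_le_mul_of_nonneg_right hn (by positivity)
          have h5 := norm_le_norm_add_norm_sub' (w s) (w τ)
          linarith
      have := hsW t ht
      rw [pow_succ]
      linarith
  intro t
  refine key n le_rfl t ?_
  rw [mul_div_cancel₀ _ hn0'.ne']
  exact t.2.2

/-! ### Solutions -/

section Solutions

variable {T : ℝ} {l d : ℕ} {σ : Vec (Fin l) → Vec (Fin l × Fin d)} {X : Driver T d} {γ κ : ℝ}
  {a : Vec (Fin l)} {Y : Triple T d (Fin l)}

/-- The second and third components of a solution are functions of the first one. -/
structure IsAdapted (σ : Vec (Fin l) → Vec (Fin l × Fin d)) (Y : Triple T d (Fin l)) :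
    Prop where
  ζ1 : ∀ t, Y.ζ1 t = σ (Y.z t)
  ζ2 : ∀ t i j k, Y.ζ2 t (i, j, k) = cof1 σ (i, j) k (Y.z t)

theorem IsAdapted.comp_ζ1 (h : IsAdapted σ Y) (t : Time T) (m : Fin l × Fin d) (k : Fin d) :
    (Y.comp σ).ζ1 t (m, k) = cof1 σ m k (Y.z t) := by
  simp only [Triple.comp, cof1, h.ζ1]

theorem IsAdapted.comp_ζ2 (h : IsAdapted σ Y) (t : Time T) (m : Fin l × Fin d)
    (j k : Fin d) : (Y.comp σ).ζ2 t (m, j, k) = cof2 σ m j k (Y.z t) := by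
  simp only [Triple.comp, cof2, h.ζ1, h.ζ2]

theorem IsAdapted.comp_r (h : IsAdapted σ Y) (X : Driver T d) (s t : Time T)
    (m : Fin l × Fin d) :
    (Y.comp σ).r X s t m = rem0 σ (X.inc s t) (Y.z s) (Y.z t) m := by
  simp only [Triple.r, rem0, h.comp_ζ1, h.comp_ζ2]
  rfl

theorem IsAdapted.comp_ρ (h : IsAdapted σ Y) (X : Driver T d) (s t : Time T)
    (m : Fin l × Fin d) (j : Fin d) :
    (Y.comp σ).ρ X s t (m, j) = rem1 σ (X.inc s t) (Y.z s) (Y.z t) m j := by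
  simp only [Triple.ρ, rem1, delta1, PiLp.sub_apply, h.comp_ζ1, h.comp_ζ2]
  rfl

/-- The remainders r and ρ of σ(y) are `rem0` and `rem1`, so the argument of Λ is the defect of the
Euler expansion. -/
theorem IsAdapted.sewing_eq (h : IsAdapted σ Y) (X : Driver T d) (s u t : Time T) :
    sewing X (Y.comp σ) s u t = defect σ (X.inc s u) (X.inc u t) (Y.z s) (Y.z u) := by
  simp only [sewing, defect, h.comp_r, h.comp_ρ, delta1, PiLp.sub_apply, h.comp_ζ2]
  rfl

theorem IsSolution.isAdapted (h : IsSolution X κ σ a Y) : IsAdapted σ Y := by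
  obtain ⟨-, -, -, h1, h2⟩ := h
  have h1 : ∀ t, Y.ζ1 t = σ (Y.z t) := h1
  refine ⟨h1, fun t i j k => ?_⟩
  rw [h2]
  simp only [Triple.comp, cof1, h1]

/-- For a solution the Euler error is the Λ term itself; no other part of the definition is needed
for the 4γ bound. -/
theorem IsSolution.memC2OnePlus (h : IsSolution X κ σ a Y) :
    MemC2OnePlus (eulerError X σ Y.z) := by
  obtain ⟨L, hL, hL'⟩ := h.2.2.1
  have : eulerError X σ Y.z = L := by
    funext s t
    ext i
    have h1 := hL' s t i
    simp only [h.isAdapted.comp_ζ1, h.isAdapted.comp_ζ2] at h1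
    change delta1 Y.z s t i - euler σ (X.inc s t) (Y.z s) i = _
    rw [h1]
    simp only [euler, Triple.comp, Driver.inc]
    ring
  rw [this]
  exact hL.1

theorem IsSolution.z_zero (h : IsSolution X κ σ a Y) (t : Time T) (ht : (t : ℝ) = 0) :
    Y.z t = a := (h.1.2 t ht).1

/-- Local Lipschitz continuity of the solution in the initial condition and the driver. -/
theorem exists_lipschitz (hT : 0 < T) (hσ : IsRegular σ) (hγ : 1 / 4 < γ) (hκγ : κ < γ)
    (M : ℝ≥0) :
    ∃ c : ℝ≥0, 0 < c ∧ ∀ X X' : Driver T d, X.IsRough γ → X.IsGeometric →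
        X'.IsRough γ → X'.IsGeometric → X.size γ ≤ M → X'.size γ ≤ M →
        ∀ (a a' : Vec (Fin l)) (Y Y' : Triple T d (Fin l)),
          IsSolution X κ σ a Y → IsSolution X' κ σ a' Y' →
          norm1 κ (fun t => Y.z t - Y'.z t) ≤
            c * (‖a - a'‖ₑ + norm1 γ (fun t => X.x t - X'.x t)
              + norm2 (2 * γ) (fun s t => X.x2 s t - X'.x2 s t)
              + norm2 (3 * γ) (fun s t => X.x3 s t - X'.x3 s t)) := by
  obtain ⟨K, hK0, hK⟩ := exists_eulerError_bound (l := l) (d := d) hσ hγ M T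
  obtain ⟨C, hC0, hC⟩ := exists_sub_holder_bound (l := l) (d := d) hσ hγ M hK0 hT.le
  obtain ⟨N, hN0, hN⟩ := exists_uniform_bound (V := Vec (Fin l)) hT hC0
    (show 0 < γ by linarith)
  have hc : 0 < C * N * T ^ (γ - κ) + 1 := by positivity
  refine ⟨(C * N * T ^ (γ - κ) + 1).toNNReal, Real.toNNReal_pos.2 hc, ?_⟩
  intro X X' hX hg hX' hg' hM hM' a a' Y Y' hY hY'
  set n1 := norm1 γ (fun t => X.x t - X'.x t)
  set n2 := norm2 (2 * γ) (fun s t => X.x2 s t - X'.x2 s t)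
  set n3 := norm2 (3 * γ) (fun s t => X.x3 s t - X'.x3 s t)
  -- In the infinite case the right-hand side is ∞ since the constant is positive.
  by_cases htop : n1 + n2 + n3 = ∞
  · rw [add_assoc, add_assoc, ← add_assoc n1, htop, add_top, ENNReal.mul_top]
    · exact le_top
    · simpa using hc
  set ε := (n1 + n2 + n3).toReal with hε
  have hε0 : 0 ≤ ε := ENNReal.toReal_nonneg
  have hεe : ENNReal.ofReal ε = n1 + n2 + n3 := ENNReal.ofReal_toReal htop
  have hXX := inc_sub_boundedBy (X := X) (X' := X') (γ := γ) hε0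
    (by rw [hεe]; exact le_add_right le_self_add) (by rw [hεe]; exact le_add_right le_add_self)
    (by rw [hεe]; exact le_add_self)
  have hw := fun W τ hW => hC X X' Y.z Y'.z hX hg hX' hg' hM hM'
    (hK X Y.z hX hg hM hY.memC2OnePlus) (hK X' Y'.z hX' hg' hM' hY'.memC2OnePlus) ε W τ hε0 hW hXX
  obtain ⟨B, hB⟩ : ∃ B : ℝ, ∀ s, ‖Y.z s - Y'.z s‖ ≤ B := by
    have hc : Continuous fun s => ‖Y.z s - Y'.z s‖ :=
      (hY.1.1.mem_z.1.sub hY'.1.1.mem_z.1).norm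
    obtain ⟨B, hB⟩ := (isCompact_range hc).bddAbove
    exact ⟨B, fun s => hB ⟨s, rfl⟩⟩
  have h1 := hN (fun t => Y.z t - Y'.z t) ε B hε0 hB fun W τ hW => hw W τ hW
  simp only [hY.z_zero ⟨0, le_rfl, hT.le⟩ rfl, hY'.z_zero ⟨0, le_rfl, hT.le⟩ rfl] at h1
  set Q := ‖a - a'‖ + ε with hQ
  have hQ0 : 0 ≤ Q := by positivity
  have h2 : ∀ s t : Time T, ‖delta1 (fun t => Y.z t - Y'.z t) s t‖ ≤
      C * N * T ^ (γ - κ) * Q * |(t : ℝ) - s| ^ κ := by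
    intro s t
    rcases eq_or_ne s t with rfl | hst
    · simp only [delta1, sub_self, norm_zero]
      positivity
    -- The choice W = N Q - ε makes W + ε equal to the bound N Q just obtained for ‖y - y'‖ + ε.
    have hW : 0 ≤ N * Q - ε := (norm_nonneg _).trans (le_sub_iff_add_le.2 (h1 s))
    have h3 := hw (N * Q - ε) (max s t) hW (fun r _ => le_sub_iff_add_le.2 (h1 r))
      s (le_max_left _ _) t (le_max_right _ _)
    have hpos : 0 < |(t : ℝ) - s| :=
      abs_pos.2 fun h => hst (Subtype.ext (sub_eq_zero.1 h).symm)
    have h4 : |(t : ℝ) - s| ^ γ ≤ T ^ (γ - κ) * |(t : ℝ) - s| ^ κ := by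
      have : |(t : ℝ) - s| ^ γ = |(t : ℝ) - s| ^ (γ - κ) * |(t : ℝ) - s| ^ κ := by
        rw [← Real.rpow_add hpos]
        ring_nf
      rw [this]
      exact mul_le_mul_of_nonneg_right (abs_sub_rpow_le (by linarith) s t) (by positivity)
    rw [sub_add_cancel] at h3
    refine h3.trans ?_
    calc _ ≤ C * (N * Q) * (T ^ (γ - κ) * |(t : ℝ) - s| ^ κ) :=
          mul_le_mul_of_nonneg_left h4 (by positivity)
      _ = _ := by ring
  refine (norm2_le_of_bound h2).trans ?_
  have e : ‖a - a'‖ₑ + n1 + n2 + n3 = ENNReal.ofReal Q := by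
    rw [hQ, ENNReal.ofReal_add (norm_nonneg _) hε0, hεe, ofReal_norm]
    ring
  rw [e, ← ENNReal.ofReal_coe_nnreal, ← ENNReal.ofReal_mul (NNReal.coe_nonneg _),
    Real.coe_toNNReal _ hc.le]
  exact ENNReal.ofReal_le_ofReal (mul_le_mul_of_nonneg_right (by linarith) hQ0)

/-- With equal data the Lipschitz estimate makes y - y' constant, hence zero as it vanishes at time
0; the other components are functions of y. -/
theorem IsSolution.unique (hT : 0 < T) (hσ : IsRegular σ) (hγ : 1 / 4 < γ) (hκγ : κ < γ)
    (hX : X.IsRough γ) (hg : X.IsGeometric) {Y Y' : Triple T d (Fin l)}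
    (hY : IsSolution X κ σ a Y) (hY' : IsSolution X κ σ a Y') : Y = Y' := by
  obtain ⟨c, -, hc⟩ := exists_lipschitz hT hσ hγ hκγ (X.size γ).toNNReal
  have hs := hX.size_le
  have h1 := hc X X hX hg hX hg hs hs a a Y Y' hY hY'
  have e2 : ∀ μ : ℝ, norm2 μ (fun _ _ : Time T => (0 : Vec (Fin d × Fin d))) = 0 := by
    simp [norm2]
  have e3 : ∀ μ : ℝ, norm2 μ (fun _ _ : Time T => (0 : Vec (Fin d × Fin d × Fin d))) = 0 := by
    simp [norm2]
  have e1 : ∀ μ : ℝ, norm1 μ (fun _ : Time T => (0 : Vec (Fin d))) = 0 := by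
    simp [norm1, norm2, delta1]
  simp only [sub_self, enorm_zero, e1, e2, e3, add_zero, mul_zero] at h1
  have hz : ∀ t, Y.z t = Y'.z t := by
    intro t
    have h2 := norm_le_of_norm2_le (C := 0) le_rfl (by simpa [norm1] using h1)
      (⟨0, le_rfl, hT.le⟩ : Time T) t
    rw [zero_mul, norm_le_zero_iff] at h2
    simp only [delta1, hY.z_zero ⟨0, le_rfl, hT.le⟩ rfl, hY'.z_zero ⟨0, le_rfl, hT.le⟩ rfl,
      sub_self, sub_zero] at h2
    exact sub_eq_zero.1 h2
  refine Triple.ext (funext hz) (funext fun t => ?_) (funext fun t => ?_)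
  · rw [hY.isAdapted.ζ1, hY'.isAdapted.ζ1, hz]
  · ext ⟨i, j, k⟩
    rw [hY.isAdapted.ζ2, hY'.isAdapted.ζ2, hz]

end Solutions

/-! ### The Euler scheme -/

section Scheme

variable {T : ℝ} {l d : ℕ} {σ : Vec (Fin l) → Vec (Fin l × Fin d)} {X : Driver T d} {γ : ℝ}

/-- The point `k T / n` of the regular grid, stopped at `T`. -/
noncomputable def grid (hT : 0 < T) (n k : ℕ) : Time T :=
  ⟨min (k * (T / n)) T, le_min (by positivity) hT.le, min_le_right _ _⟩

theorem grid_coe (hT : 0 < T) {n k : ℕ} (hn : 0 < n) (hk : k ≤ n) :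
    (grid hT n k : ℝ) = k * (T / n) := by
  refine min_eq_left ?_
  have hn' : (0 : ℝ) < n := by exact_mod_cast hn
  rw [mul_div_assoc', div_le_iff₀ hn', mul_comm]
  exact mul_le_mul_of_nonneg_left (by exact_mod_cast hk) hT.le

/-- The Euler scheme along the regular grid. -/
noncomputable def scheme (X : Driver T d) (σ : Vec (Fin l) → Vec (Fin l × Fin d)) (hT : 0 < T)
    (a : Vec (Fin l)) (n : ℕ) : ℕ → Vec (Fin l)
  | 0 => a
  | k + 1 => scheme X σ hT a n k +
      euler σ (X.inc (grid hT n k) (grid hT n (k + 1))) (scheme X σ hT a n k)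

theorem euler_inc_self (hX : X.IsRough γ) (s : Time T) (a : Vec (Fin l)) :
    euler σ (X.inc s s) a = 0 := by
  ext i
  simp [euler, Driver.inc, delta1, hX.mem_x2.1, hX.mem_x3.1]

/-- The error of the Euler scheme between two points of the grid. -/
noncomputable def schemeError (X : Driver T d) (σ : Vec (Fin l) → Vec (Fin l × Fin d))
    (hT : 0 < T) (a : Vec (Fin l)) (n i j : ℕ) : Vec (Fin l) :=
  scheme X σ hT a n j - scheme X σ hT a n i
    - euler σ (X.inc (grid hT n i) (grid hT n j)) (scheme X σ hT a n i)

theorem schemeError_chen (hX : X.IsRough γ) (hT : 0 < T) (a : Vec (Fin l)) (n i m j : ℕ) :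
    schemeError X σ hT a n i j = schemeError X σ hT a n i m + schemeError X σ hT a n m j
      + defect σ (X.inc (grid hT n i) (grid hT n m)) (X.inc (grid hT n m) (grid hT n j))
        (scheme X σ hT a n i) (scheme X σ hT a n m) := by
  have := euler_chen (σ := σ) hX (grid hT n i) (grid hT n m) (grid hT n j)
    (scheme X σ hT a n i) (scheme X σ hT a n m)
  rw [← eq_sub_iff_add_eq'] at this
  rw [this]
  simp only [schemeError]
  abel

/-- Exactness over single steps replaces, in the discrete setting, the a priori smallness of the
error at small scales. -/
theorem schemeError_succ (hT : 0 < T) (a : Vec (Fin l)) (n i : ℕ) :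
    schemeError X σ hT a n i (i + 1) = 0 := by
  simp only [schemeError, scheme]
  abel

/-- The Euler scheme satisfies a bound of order `4 γ` which does not depend on the mesh. -/
theorem exists_schemeError_bound (hσ : IsRegular σ) (hγ : 1 / 4 < γ) (hT : 0 < T)
    (hX : X.IsRough γ) (hg : X.IsGeometric) {M : ℝ≥0} (hM : X.size γ ≤ M) :
    ∃ K : ℝ, 0 ≤ K ∧ ∀ (a : Vec (Fin l)) (n : ℕ), 0 < n → ∀ i j : ℕ, i ≤ j → j ≤ n →
      ‖schemeError X σ hT a n i j‖ ≤
        K * |(grid hT n j : ℝ) - grid hT n i| ^ (4 * γ) := by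
  have hγ0 : 0 < γ := by linarith
  obtain ⟨C, hC0, hC⟩ := exists_defect_bound_single hσ (Λ := T ^ γ) M.coe_nonneg
  obtain ⟨c, hc0, hc⟩ := exists_halving_weight hC0 hγ0
  have hμ : 1 < 4 * γ := by linarith
  have h2 : (2 : ℝ) ^ (1 - 4 * γ) < 1 :=
    Real.rpow_lt_one_of_one_lt_of_neg one_lt_two (by linarith)
  set B := 2 * C / (1 - (2 : ℝ) ^ (1 - 4 * γ)) with hB
  have hB0 : 0 ≤ B := div_nonneg (by linarith) (by linarith)
  have hb := inc_boundedBy_of_size hM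
  have hmono : ∀ h h' : ℝ, 0 ≤ h → h ≤ h' →
      B * (h ^ (4 * γ) * Real.exp (c * h ^ γ)) ≤ B * (h' ^ (4 * γ) * Real.exp (c * h' ^ γ)) := by
    intro h h' hh hh'
    have i1 : h ^ γ ≤ h' ^ γ := Real.rpow_le_rpow hh hh' hγ0.le
    have i2 : h ^ (4 * γ) ≤ h' ^ (4 * γ) := Real.rpow_le_rpow hh hh' (by linarith)
    have i3 : 0 ≤ h' := hh.trans hh'
    gcongr
  -- Induction on a bound N for the number of grid steps between i and j.
  have key : ∀ (a : Vec (Fin l)) (n : ℕ), 0 < n → ∀ N i j : ℕ, i ≤ j → j ≤ n → j ≤ i + N →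
      ‖schemeError X σ hT a n i j‖ ≤ B * (|(grid hT n j : ℝ) - grid hT n i| ^ (4 * γ) *
        Real.exp (c * |(grid hT n j : ℝ) - grid hT n i| ^ γ)) := by
    intro a n hn N
    have hδ : 0 ≤ T / n := by positivity
    have hdist : ∀ i j : ℕ, i ≤ j → j ≤ n →
        |(grid hT n j : ℝ) - grid hT n i| = ((j : ℝ) - i) * (T / n) := by
      intro i j hij hj
      rw [grid_coe hT hn hj, grid_coe hT hn (hij.trans hj), ← sub_mul, abs_of_nonneg]
      exact mul_nonneg (sub_nonneg.2 (by exact_mod_cast hij)) hδ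
    induction N with
    | zero =>
      intro i j hij hj hN
      obtain rfl : i = j := by omega
      rw [schemeError, euler_inc_self hX, sub_self, sub_self, norm_zero]
      positivity
    | succ N ih =>
      intro i j hij hj hN
      rcases Nat.lt_or_ge j (i + 2) with hlt | hge
      · rcases hij.eq_or_lt with rfl | hlt'
        · exact ih i i le_rfl hj (by omega)
        · obtain rfl : j = i + 1 := by omega
          rw [schemeError_succ, norm_zero]
          positivity
      -- The step from m to m + 1 carries no error, and with this m both [i, m] and [m + 1, j] have
      -- at most half the length of [i, j], whatever the parity. Cutting twice produces two defects,
      -- hence 2C in the constant B.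
      obtain ⟨m, hm⟩ : ∃ m, m = i + (j - i) / 2 := ⟨_, rfl⟩
      have him : i ≤ m := by omega
      have hmj : m + 1 ≤ j := by omega
      have hm1 : 2 * ((m : ℝ) - i) ≤ j - i := by
        have : 2 * m ≤ j + i := by omega
        have : (2 : ℝ) * m ≤ j + i := by exact_mod_cast this
        linarith
      have hm2 : 2 * ((j : ℝ) - (m + 1 : ℕ)) ≤ j - i := by
        have : j + i ≤ 2 * (m + 1) := by omega
        have : (j : ℝ) + i ≤ 2 * ((m + 1 : ℕ) : ℝ) := by exact_mod_cast this
        linarith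
      have i1 := ih i m him (by omega) (by omega)
      have i2 := ih (m + 1) j hmj hj (by omega)
      have hlT := abs_sub_rpow_le hγ0.le (grid hT n i) (grid hT n j)
      have hsub : ∀ p q : ℕ, i ≤ p → p ≤ q → q ≤ j →
          (X.inc (grid hT n p) (grid hT n q)).BoundedBy M
            (|(grid hT n j : ℝ) - grid hT n i| ^ γ) := by
        intro p q hp hpq hq
        refine (hb _ _).mono M.coe_nonneg le_rfl (Real.rpow_nonneg (abs_nonneg _) _)
          (Real.rpow_le_rpow (abs_nonneg _) ?_ hγ0.le)
        rw [hdist p q hpq (hq.trans hj), hdist i j hij hj]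
        have h3 : (i : ℝ) ≤ p := by exact_mod_cast hp
        have h4 : (q : ℝ) ≤ j := by exact_mod_cast hq
        exact mul_le_mul_of_nonneg_right (by linarith) hδ
      have hgeo := inc_isGeometric hX hg
      have hl0 : 0 ≤ |(grid hT n j : ℝ) - grid hT n i| ^ γ := Real.rpow_nonneg (abs_nonneg _) _
      have d1 := hC _ hl0 hlT _ _ (hsub i m le_rfl him (by omega)) (hsub m j him (by omega) le_rfl)
        (hgeo _ _) (hgeo _ _) (scheme X σ hT a n i) (scheme X σ hT a n m)
      have d2 := hC _ hl0 hlT _ _ (hsub m (m + 1) him (by omega) hmj)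
        (hsub (m + 1) j (by omega) hmj le_rfl)
        (hgeo _ _) (hgeo _ _) (scheme X σ hT a n m) (scheme X σ hT a n (m + 1))
      rw [← schemeError, rpow_pow_eq (abs_nonneg _)] at d1 d2
      rw [schemeError_succ, norm_zero, mul_zero, zero_add] at d2
      rw [schemeError_chen hX hT a n i m j, schemeError_chen hX hT a n m (m + 1) j,
        schemeError_succ, zero_add]
      have n1 := norm_add₃_le (a := schemeError X σ hT a n i m)
        (b := schemeError X σ hT a n (m + 1) j + defect σ
          (X.inc (grid hT n m) (grid hT n (m + 1))) (X.inc (grid hT n (m + 1)) (grid hT n j))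
          (scheme X σ hT a n m) (scheme X σ hT a n (m + 1)))
        (c := defect σ (X.inc (grid hT n i) (grid hT n m)) (X.inc (grid hT n m) (grid hT n j))
          (scheme X σ hT a n i) (scheme X σ hT a n m))
      have n2 := norm_add_le (schemeError X σ hT a n (m + 1) j) (defect σ
          (X.inc (grid hT n m) (grid hT n (m + 1))) (X.inc (grid hT n (m + 1)) (grid hT n j))
          (scheme X σ hT a n m) (scheme X σ hT a n (m + 1)))
      have k1 := i1.trans (hmono _ (|(grid hT n j : ℝ) - grid hT n i| / 2) (abs_nonneg _) (by
        rw [hdist i m him (by omega), hdist i j hij hj]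
        have := mul_le_mul_of_nonneg_right hm1 hδ
        linarith))
      have k2 := i2.trans (hmono _ (|(grid hT n j : ℝ) - grid hT n i| / 2) (abs_nonneg _) (by
        rw [hdist (m + 1) j hmj hj, hdist i j hij hj]
        have := mul_le_mul_of_nonneg_right hm2 hδ
        linarith))
      have hh0 : 0 ≤ |(grid hT n j : ℝ) - grid hT n i| := abs_nonneg _
      set h := |(grid hT n j : ℝ) - grid hT n i|
      have k3 := halving_majorant hμ hc0 hc (B := 2 * C) (by linarith) hh0
      rw [← hB] at k3
      have k4 := mul_le_mul_of_nonneg_left k1 (show 0 ≤ 1 + C * h ^ γ by positivity)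
      push_cast at d1 d2
      linarith
  refine ⟨B * Real.exp (c * T ^ γ), by positivity, fun a n hn i j hij hj => ?_⟩
  refine (key a n hn j i j hij hj (by omega)).trans ?_
  have h3 := Real.exp_le_exp.2 (mul_le_mul_of_nonneg_left
    (abs_sub_rpow_le hγ0.le (grid hT n i) (grid hT n j)) hc0)
  calc _ ≤ B * (|(grid hT n j : ℝ) - grid hT n i| ^ (4 * γ) * Real.exp (c * T ^ γ)) := by gcongr
    _ = _ := by ring

end Scheme

/-! ### Continuity -/

section Continuity

variable {T : ℝ} {l d : ℕ} {σ : Vec (Fin l) → Vec (Fin l × Fin d)} {X : Driver T d} {γ : ℝ}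

theorem MemC2.tendsto_zero {β : Type*} {F : Filter β} {V : Type} [NormedAddCommGroup V] {μ : ℝ}
    (hμ : 0 < μ) {f : Time T → Time T → V} (hf : MemC2 μ f) {u v : β → Time T} {s : Time T}
    (hu : Tendsto u F (nhds s)) (hv : Tendsto v F (nhds s)) :
    Tendsto (fun b => f (u b) (v b)) F (nhds 0) := by
  obtain ⟨C, hC⟩ := hf.bound
  refine squeeze_zero_norm (fun b => hC (u b) (v b)) ?_
  have h1 : Tendsto (fun b => |((v b : Time T) : ℝ) - u b|) F (nhds 0) := by
    have := ((continuous_subtype_val.tendsto s).comp hv).sub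
      ((continuous_subtype_val.tendsto s).comp hu)
    simpa using this.abs
  have h2 := (h1.rpow_const (Or.inr hμ.le : (0 : ℝ) ≠ 0 ∨ 0 ≤ μ)).const_mul C
  rwa [Real.zero_rpow hμ.ne', mul_zero] at h2

theorem tendsto_apply {β : Type*} {F : Filter β} {ι : Type} [Fintype ι] {f : β → Vec ι}
    {v : Vec ι} (h : Tendsto f F (nhds v)) (i : ι) :
    Tendsto (fun b => f b i) F (nhds (v i)) :=
  ((EuclideanSpace.proj (𝕜 := ℝ) i).continuous.tendsto v).comp h

variable {β : Type*} {F : Filter β} {u v : β → Time T} {s t : Time T}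

theorem tendsto_delta1 (hX : X.IsRough γ) (hu : Tendsto u F (nhds s)) (hv : Tendsto v F (nhds t))
    (i : Fin d) : Tendsto (fun b => delta1 X.x (u b) (v b) i) F (nhds (delta1 X.x s t i)) :=
  tendsto_apply (((hX.mem_x.1.tendsto t).comp hv).sub ((hX.mem_x.1.tendsto s).comp hu)) i

/-- Joint continuity is not assumed but follows from Chen's relation: insert the limit times s and
t, and let the increments over the short pieces tend to 0. -/
theorem tendsto_x2 (hγ : 0 < γ) (hX : X.IsRough γ) (hu : Tendsto u F (nhds s))
    (hv : Tendsto v F (nhds t)) (i j : Fin d) :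
    Tendsto (fun b => X.x2 (u b) (v b) (i, j)) F (nhds (X.x2 s t (i, j))) := by
  have hs : Tendsto (fun _ : β => s) F (nhds s) := tendsto_const_nhds
  have ht : Tendsto (fun _ : β => t) F (nhds t) := tendsto_const_nhds
  have e : ∀ b, X.x2 (u b) s (i, j) + (X.x2 s t (i, j) + X.x2 t (v b) (i, j)
      + delta1 X.x s t i * delta1 X.x t (v b) j) + delta1 X.x (u b) s i * delta1 X.x s (v b) j =
      X.x2 (u b) (v b) (i, j) := fun b => by
    rw [chen2_apply hX (u b) s (v b), chen2_apply hX s t (v b)]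
  have t1 := tendsto_apply (hX.mem_x2.tendsto_zero (by linarith) hu hs) (i, j)
  have t2 := tendsto_apply (hX.mem_x2.tendsto_zero (by linarith) ht hv) (i, j)
  have t3 := (t2.const_add (X.x2 s t (i, j))).add
    ((tendsto_delta1 hX ht hv j).const_mul (delta1 X.x s t i))
  have t4 := (t1.add t3).add ((tendsto_delta1 hX hu hs i).mul (tendsto_delta1 hX hs hv j))
  refine (t4.congr e).trans_eq ?_
  simp [delta1]

theorem tendsto_x3 (hγ : 0 < γ) (hX : X.IsRough γ) (hu : Tendsto u F (nhds s))
    (hv : Tendsto v F (nhds t)) (i j k : Fin d) :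
    Tendsto (fun b => X.x3 (u b) (v b) (i, j, k)) F (nhds (X.x3 s t (i, j, k))) := by
  have hs : Tendsto (fun _ : β => s) F (nhds s) := tendsto_const_nhds
  have ht : Tendsto (fun _ : β => t) F (nhds t) := tendsto_const_nhds
  have e : ∀ b, X.x3 (u b) s (i, j, k) + (X.x3 s t (i, j, k) + X.x3 t (v b) (i, j, k)
      + X.x2 s t (i, j) * delta1 X.x t (v b) k + delta1 X.x s t i * X.x2 t (v b) (j, k))
      + X.x2 (u b) s (i, j) * delta1 X.x s (v b) k + delta1 X.x (u b) s i * X.x2 s (v b) (j, k) =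
      X.x3 (u b) (v b) (i, j, k) := fun b => by
    rw [chen3_apply hX (u b) s (v b), chen3_apply hX s t (v b)]
  have t1 := tendsto_apply (hX.mem_x3.tendsto_zero (by linarith) hu hs) (i, j, k)
  have t2 := tendsto_apply (hX.mem_x3.tendsto_zero (by linarith) ht hv) (i, j, k)
  have t3 := ((t2.const_add (X.x3 s t (i, j, k))).add
    ((tendsto_delta1 hX ht hv k).const_mul (X.x2 s t (i, j)))).add
    ((tendsto_x2 hγ hX ht hv j k).const_mul (delta1 X.x s t i))
  have t4 := ((t1.add t3).add ((tendsto_x2 hγ hX hu hs i j).mul (tendsto_delta1 hX hs hv k))).add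
    ((tendsto_delta1 hX hu hs i).mul (tendsto_x2 hγ hX hs hv j k))
  refine (t4.congr e).trans_eq ?_
  simp [delta1, hX.mem_x2.1]

theorem CbPd.continuous {ι : Type} [Fintype ι] [DecidableEq ι] {n : ℕ} {G : Vec ι → ℝ}
    (h : CbPd (n + 1) G) : Continuous G :=
  h.2.1.continuous

theorem tendsto_euler (hσ : IsRegular σ) (hγ : 0 < γ) (hX : X.IsRough γ)
    (hu : Tendsto u F (nhds s)) (hv : Tendsto v F (nhds t)) {z : β → Vec (Fin l)}
    {y : Vec (Fin l)} (hz : Tendsto z F (nhds y)) :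
    Tendsto (fun b => euler σ (X.inc (u b) (v b)) (z b)) F (nhds (euler σ (X.inc s t) y)) := by
  refine ((PiLp.continuous_toLp 2 _).tendsto _).comp (tendsto_pi_nhds.2 fun i => ?_)
  refine ((tendsto_finsetSum _ fun j _ => ?_).add
    (tendsto_finsetSum _ fun j _ => tendsto_finsetSum _ fun k _ => ?_)).add
    (tendsto_finsetSum _ fun j _ => tendsto_finsetSum _ fun k₁ _ => tendsto_finsetSum _ fun k₂ _ => ?_)
  · exact (((hσ.cb (i, j)).continuous.tendsto y).comp hz).mul (tendsto_delta1 hX hu hv j)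
  · exact (((hσ.cof1 (i, j) k).continuous.tendsto y).comp hz).mul (tendsto_x2 hγ hX hu hv k j)
  · exact (((hσ.cof2 (i, j) k₁ k₂).continuous.tendsto y).comp hz).mul
      (tendsto_x3 hγ hX hu hv k₂ k₁ j)

end Continuity

/-! ### Limits of the Euler scheme -/

section Limit

variable {T : ℝ} {l d : ℕ} {σ : Vec (Fin l) → Vec (Fin l × Fin d)} {X : Driver T d} {γ : ℝ}

/-- The index of the last point of the grid before `t`. -/
noncomputable def gridIndex (n : ℕ) (t : Time T) : ℕ := ⌊(t : ℝ) / (T / n)⌋₊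

theorem gridIndex_le (hT : 0 < T) {n : ℕ} (hn : 0 < n) (t : Time T) : gridIndex n t ≤ n := by
  have hn' : (0 : ℝ) < n := by exact_mod_cast hn
  refine Nat.floor_le_of_le ?_
  rw [div_le_iff₀ (by positivity), mul_div_cancel₀ _ hn'.ne']
  exact t.2.2

theorem gridIndex_mono (hT : 0 < T) (n : ℕ) {s t : Time T} (h : s ≤ t) :
    gridIndex n s ≤ gridIndex n t :=
  Nat.floor_mono (div_le_div_of_nonneg_right h (by positivity))

theorem abs_grid_sub_le (hT : 0 < T) {n : ℕ} (hn : 0 < n) (t : Time T) :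
    |(grid hT n (gridIndex n t) : ℝ) - t| ≤ T / n := by
  have hn' : (0 : ℝ) < n := by exact_mod_cast hn
  have hδ : 0 < T / n := by positivity
  rw [grid_coe hT hn (gridIndex_le hT hn t), abs_le]
  have h1 := Nat.floor_le (show 0 ≤ (t : ℝ) / (T / n) from div_nonneg t.2.1 hδ.le)
  have h2 := Nat.lt_floor_add_one ((t : ℝ) / (T / n))
  rw [le_div_iff₀ hδ] at h1
  rw [div_lt_iff₀ hδ] at h2
  change (gridIndex n t : ℝ) * (T / n) ≤ t at h1
  change (t : ℝ) < ((gridIndex n t : ℝ) + 1) * (T / n) at h2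
  constructor <;> linarith

theorem tendsto_grid (hT : 0 < T) (t : Time T) :
    Tendsto (fun n : ℕ => grid hT (n + 1) (gridIndex (n + 1) t)) atTop (nhds t) := by
  rw [tendsto_subtype_rng, tendsto_iff_norm_sub_tendsto_zero]
  refine squeeze_zero (fun _ => norm_nonneg _)
    (fun n => abs_grid_sub_le hT (Nat.succ_pos n) t) ?_
  exact (tendsto_const_div_atTop_nhds_zero_nat T).comp (tendsto_add_atTop_nat 1)

/-- There is a path starting at `a` whose Euler error is of order `4 γ`. -/
theorem exists_path (hσ : IsRegular σ) (hγ : 1 / 4 < γ) (hT : 0 < T)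
    (hX : X.IsRough γ) (hg : X.IsGeometric) {M : ℝ≥0} (hM : X.size γ ≤ M) (a : Vec (Fin l)) :
    ∃ (y : Time T → Vec (Fin l)) (K : ℝ), (∀ t : Time T, (t : ℝ) = 0 → y t = a) ∧
      ∀ s t, ‖eulerError X σ y s t‖ ≤ K * |(t : ℝ) - s| ^ (4 * γ) := by
  have hγ0 : 0 < γ := by linarith
  obtain ⟨K, hK0, hK⟩ := exists_schemeError_bound (l := l) hσ hγ hT hX hg hM
  obtain ⟨E, hE0, hE⟩ := exists_euler_bound_single hσ (Λ := T ^ γ) M.coe_nonneg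
  obtain ⟨C, hC0, hC⟩ := exists_defect_bound_single hσ (Λ := T ^ γ) M.coe_nonneg
  have hb := inc_boundedBy_of_size hM
  have hgeo := inc_isGeometric hX hg
  -- The scheme is read at the last grid point before t; the shift to n + 1 excludes the empty grid.
  let z : Time T → ℕ → Vec (Fin l) := fun t n => scheme X σ hT a (n + 1) (gridIndex (n + 1) t)
  have hz : ∀ t n, z t n ∈ Metric.closedBall a (K * T ^ (4 * γ) + E * T ^ γ) := by
    intro t n
    have h1 := hK a (n + 1) (Nat.succ_pos n) 0 _ (Nat.zero_le _)
      (gridIndex_le hT (Nat.succ_pos n) t)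
    have h2 := (hE _ (Real.rpow_nonneg (abs_nonneg _) _) (abs_sub_rpow_le hγ0.le _ _) _
      (hb (grid hT (n + 1) 0) (grid hT (n + 1) (gridIndex (n + 1) t))) (hgeo _ _) a a).1
    have h3 := mul_le_mul_of_nonneg_left (abs_sub_rpow_le hγ0.le (grid hT (n + 1) 0)
      (grid hT (n + 1) (gridIndex (n + 1) t))) hE0
    have h4 := mul_le_mul_of_nonneg_left (abs_sub_rpow_le (show 0 ≤ 4 * γ by linarith)
      (grid hT (n + 1) 0) (grid hT (n + 1) (gridIndex (n + 1) t))) hK0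
    have h5 := norm_add_le (schemeError X σ hT a (n + 1) 0 (gridIndex (n + 1) t))
      (euler σ (X.inc (grid hT (n + 1) 0) (grid hT (n + 1) (gridIndex (n + 1) t))) a)
    rw [mem_closedBall_iff_norm]
    have e : schemeError X σ hT a (n + 1) 0 (gridIndex (n + 1) t) +
        euler σ (X.inc (grid hT (n + 1) 0) (grid hT (n + 1) (gridIndex (n + 1) t))) a =
        z t n - a := by
      simp only [schemeError, scheme, z]
      abel
    rw [e] at h5
    linarith
  -- One ultrafilter gives limits at all times simultaneously, without extraction of subsequences;
  -- continuity of the limit will come from the error bound.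
  have hlim : ∀ t, ∃ y, Tendsto (z t) (hyperfilter ℕ) (nhds y) := by
    intro t
    obtain ⟨y, -, hy⟩ := (isCompact_closedBall a (K * T ^ (4 * γ) + E * T ^ γ)).ultrafilter_le_nhds
      ((hyperfilter ℕ).map (z t)) (le_principal_iff.2 (Filter.mem_map.2
        (Filter.univ_mem' fun n => hz t n)))
    exact ⟨y, hy⟩
  choose y hy using hlim
  have hgrid : ∀ t : Time T, Tendsto (fun n : ℕ => grid hT (n + 1) (gridIndex (n + 1) t))
      (hyperfilter ℕ) (nhds t) := fun t => (tendsto_grid hT t).mono_left Nat.hyperfilter_le_atTop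
  have hforward : ∀ s t : Time T, s ≤ t →
      ‖eulerError X σ y s t‖ ≤ K * |(t : ℝ) - s| ^ (4 * γ) := by
    intro s t hst
    have h1 := (((hy t).sub (hy s)).sub
      (tendsto_euler hσ hγ0 hX (hgrid s) (hgrid t) (hy s))).norm
    have h2 := ((((continuous_subtype_val.tendsto t).comp (hgrid t)).sub
      ((continuous_subtype_val.tendsto s).comp (hgrid s))).abs.rpow_const
      (Or.inr (by linarith) : _ ∨ 0 ≤ 4 * γ)).const_mul K
    exact le_of_tendsto_of_tendsto' h1 h2 fun n => hK a (n + 1) (Nat.succ_pos n) _ _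
      (gridIndex_mono hT _ hst) (gridIndex_le hT (Nat.succ_pos n) t)
  refine ⟨y, K + C * (T ^ γ * K + 1), fun t ht => ?_, fun s t => ?_⟩
  · have h1 : ∀ n, z t n = a := fun n => by simp [z, gridIndex, ht, scheme]
    refine tendsto_nhds_unique (hy t) ?_
    rw [funext h1]
    exact tendsto_const_nhds
  · have hl0 : 0 ≤ |(t : ℝ) - s| ^ γ := Real.rpow_nonneg (abs_nonneg _) _
    have hl1 : 0 ≤ |(t : ℝ) - s| ^ (4 * γ) := Real.rpow_nonneg (abs_nonneg _) _
    have hTγ : 0 ≤ T ^ γ := Real.rpow_nonneg hT.le _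
    rcases le_total s t with hst | hst
    · refine (hforward s t hst).trans (mul_le_mul_of_nonneg_right ?_ hl1)
      have : 0 ≤ C * (T ^ γ * K + 1) := by positivity
      linarith
    -- For reversed times, the vanishing error from t to t splits at s into the forward error, the
    -- wanted one and a defect, which is of order 4γ by the forward bound.
    · have h1 := hforward t s hst
      have hb1 := hb t s
      rw [abs_sub_comm] at h1 hb1
      have h2 := hC _ hl0 (abs_sub_rpow_le hγ0.le s t) _ _ hb1 (hb s t) (hgeo _ _) (hgeo _ _)
        (y t) (y s)
      rw [← eulerError, rpow_pow_eq (abs_nonneg _)] at h2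
      have h3 := eulerError_chen (σ := σ) hX y t s t
      have h4 : eulerError X σ y t t = 0 := by
        rw [eulerError, euler_inc_self hX, sub_self, sub_self]
      rw [h4] at h3
      have h5 : eulerError X σ y s t =
          -(eulerError X σ y t s + defect σ (X.inc t s) (X.inc s t) (y t) (y s)) := by
        rw [eq_neg_iff_add_eq_zero, h3]
        abel
      rw [h5, norm_neg]
      refine (norm_add_le _ _).trans ?_
      push_cast at h2
      have h6 : |(t : ℝ) - s| ^ γ * ‖eulerError X σ y t s‖ ≤
          T ^ γ * (K * |(t : ℝ) - s| ^ (4 * γ)) :=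
        mul_le_mul (abs_sub_rpow_le hγ0.le s t) h1 (norm_nonneg _) hTγ
      have h7 := mul_le_mul_of_nonneg_left h6 hC0
      linarith

end Limit

/-! ### From the Euler expansion to a solution -/

section Existence

variable {T : ℝ} {l d : ℕ} {σ : Vec (Fin l) → Vec (Fin l × Fin d)} {X : Driver T d} {γ κ : ℝ}

theorem memC2_of_isBigO {ι : Type} [Fintype ι] [DecidableEq ι] {μ : ℝ} {k : ℕ} (hμ : 0 < μ)
    (hμk : μ ≤ k * γ) {f : Time T → Time T → Vec ι}
    (h : ∀ i, (fun p : Time T × Time T => f p.1 p.2 i) =O[⊤]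
      fun p => (|(p.2 : ℝ) - p.1| ^ γ) ^ k) : MemC2 μ f := by
  obtain ⟨C, hC⟩ := isBigO_top.1 (isBigO_of_coord (f := fun p : Time T × Time T => f p.1 p.2) h)
  refine memC2_of_bound (C := C) hμ hμk fun s t => ?_
  have h1 := hC (s, t)
  rwa [Real.norm_of_nonneg (by positivity), rpow_pow_eq (abs_nonneg _)] at h1

theorem memC1_of_isBigO {ι : Type} [Fintype ι] [DecidableEq ι] {μ : ℝ} (hμ : 0 < μ)
    (hμγ : μ ≤ γ) {f : Time T → Vec ι}
    (h : ∀ i, (fun p : Time T × Time T => f p.2 i - f p.1 i) =O[⊤]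
      fun p => (|(p.2 : ℝ) - p.1| ^ γ) ^ 1) : MemC1 μ f := by
  obtain ⟨C, hC⟩ := (memC2_of_isBigO (f := delta1 f) (k := 1) (hμ.trans_le hμγ) (by simp) h).bound
  exact memC1_of_bound hμ hμγ hC

/-- The triple associated with a path. -/
noncomputable def liftPath (σ : Vec (Fin l) → Vec (Fin l × Fin d)) (y : Time T → Vec (Fin l)) :
    Triple T d (Fin l) where
  z := y
  ζ1 t := σ (y t)
  ζ2 t := WithLp.toLp 2 fun p => cof1 σ (p.1, p.2.1) p.2.2 (y t)

theorem liftPath_isAdapted (y : Time T → Vec (Fin l)) :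
    IsAdapted σ (liftPath (T := T) (d := d) σ y) :=
  ⟨fun _ => rfl, fun _ _ _ _ => rfl⟩

/-- The orders proved for pairs are applied to a pair of equal objects with om = 0. They give order
3 for the r and order 2 for the ρ of both y and σ(y), in powers of h^γ, which suffices since κ < γ.
The Euler error serves as the Λ term, because its δ is the defect and 4γ > 1. -/
theorem liftPath_isSolution (hσ : IsRegular σ) (hγ : 1 / 4 < γ) (hκ : 0 < κ) (hκγ : κ < γ)
    (hX : X.IsRough γ) (hg : X.IsGeometric) {M : ℝ≥0} (hM : X.size γ ≤ M) {a : Vec (Fin l)}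
    {y : Time T → Vec (Fin l)} {K : ℝ} (ha : ∀ t : Time T, (t : ℝ) = 0 → y t = a)
    (hy : ∀ s t, ‖eulerError X σ y s t‖ ≤ K * |(t : ℝ) - s| ^ (4 * γ)) :
    IsSolution X κ σ a (liftPath σ y) := by
  have hγ0 : 0 < γ := by linarith
  have hY := liftPath_isAdapted (T := T) (σ := σ) y
  let lam : Time T × Time T → ℝ := fun p => |(p.2 : ℝ) - p.1| ^ γ
  have hl0 : ∀ p, 0 ≤ lam p := fun p => Real.rpow_nonneg (abs_nonneg _) _
  have hl : lam =O[⊤] fun _ => (1 : ℝ) := isBigO_top.2 ⟨T ^ γ, fun p => by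
    rw [Real.norm_of_nonneg (hl0 p), norm_one, mul_one]
    exact abs_sub_rpow_le hγ0.le _ _⟩
  have hb := inc_boundedBy_of_size hM
  have ha0 : (fun p : Time T × Time T => y p.1 - y p.1) =O[⊤] fun _ => (0 : ℝ) := by
    simpa using isBigO_zero (E' := Vec (Fin l)) (fun _ : Time T × Time T => (0 : ℝ)) ⊤
  have hξ : OrdIncr lam (fun _ => 0) (fun p => X.inc p.1 p.2) fun p => X.inc p.1 p.2 :=
    ordIncr_of_bound hl0 (fun _ => le_rfl) (fun p => hb p.1 p.2) (fun p => hb p.1 p.2)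
      fun p => Incr.boundedBy_sub_self _ le_rfl (hl0 p)
  have hJ : ∀ i, Ord lam (fun _ => 0) 3 (fun p => eulerError X σ y p.1 p.2 i)
      fun p => eulerError X σ y p.1 p.2 i := by
    intro i
    have h4 : Ord lam (fun _ => 0) 4 (fun p => eulerError X σ y p.1 p.2 i)
        fun p => eulerError X σ y p.1 p.2 i :=
      ord_of_bound (f := fun p => eulerError X σ y p.1 p.2) hl0 (fun _ => le_rfl)
        (fun p => by
          rw [rpow_pow_eq (abs_nonneg _)]
          exact_mod_cast hy p.1 p.2)
        (fun p => by
          rw [rpow_pow_eq (abs_nonneg _)]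
          exact_mod_cast hy p.1 p.2) (fun p => by simp) i
    exact h4.weaken hl (by norm_num)
  have hgeo : ∀ p : Time T × Time T, (X.inc p.1 p.2).IsGeometric := fun p =>
    inc_isGeometric hX hg _ _
  have ey : ∀ p : Time T × Time T,
      y p.1 + (euler σ (X.inc p.1 p.2) (y p.1) + eulerError X σ y p.1 p.2) = y p.2 := fun p => by
    simp only [eulerError]
    abel
  have hΔ : ∀ i, Ord lam (fun _ => 0) 1
      (fun p => (euler σ (X.inc p.1 p.2) (y p.1) + eulerError X σ y p.1 p.2) i)
      fun p => (euler σ (X.inc p.1 p.2) (y p.1) + eulerError X σ y p.1 p.2) i := fun i =>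
    (ord_euler hσ hl ha0 hξ i).add ((hJ i).weaken hl (by norm_num))
  have o_y : ∀ i, Ord lam (fun _ => 0) 1 (fun p => y p.2 i - y p.1 i)
      fun p => y p.2 i - y p.1 i := fun i =>
    (hΔ i).congr (fun p => by simp only [eulerError, PiLp.add_apply, PiLp.sub_apply]; ring)
      fun p => by simp only [eulerError, PiLp.add_apply, PiLp.sub_apply]; ring
  have o_F : ∀ G : Vec (Fin l) → ℝ, CbPd 2 G → Ord lam (fun _ => 0) 1
      (fun p => G (y p.2) - G (y p.1)) fun p => G (y p.2) - G (y p.1) := fun G hG => by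
    simpa only [ey] using Ord.taylor_one hl hG ha0 hΔ
  have o_r0 := fun m => ord_rem0 hσ hl ha0 hξ hgeo hgeo hJ m
  have o_r1 := fun m j => ord_rem1 hσ hl ha0 hξ hJ m j
  simp only [ey] at o_r0 o_r1
  have m_σ : MemC1 κ fun t => σ (y t) := memC1_of_isBigO hκ hκγ.le fun m =>
    (o_F _ (hσ.cb m).mono.mono).left
  have hcy : (liftPath (d := d) σ y).IsControlled X κ := by
    refine ⟨memC1_of_isBigO hκ hκγ.le fun i => (o_y i).left, m_σ,
      memC1_of_isBigO hκ hκγ.le fun p => (o_F _ (hσ.cof1 (p.1, p.2.1) p.2.2).mono).left,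
      memC2_of_isBigO (k := 3) (γ := γ) (by linarith) (by push_cast; linarith) fun i => ?_,
      memC2_of_isBigO (k := 2) (γ := γ) (by linarith) (by push_cast; linarith) fun m => ?_⟩
    · refine ((ord_third hσ ha0 hξ i).add (hJ i)).left.congr_left fun p => ?_
      simp only [Triple.r, liftPath, eulerError, euler, delta1, Driver.inc, PiLp.sub_apply]
      ring
    · have h2 : Ord lam (fun _ => 0) 2
          (fun p => ∑ j, ∑ k, cof2 σ m j k (y p.1) * (X.inc p.1 p.2).x2 (k, j))
          (fun p => ∑ j, ∑ k, cof2 σ m j k (y p.1) * (X.inc p.1 p.2).x2 (k, j)) := by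
        refine Ord.sum _ fun j _ => Ord.sum _ fun k _ => ?_
        simpa using (hσ.ord_cof2 ha0 m j k).mul (hξ.x2 (k, j))
      refine (((o_r0 m).weaken hl (by norm_num)).add h2).left.congr_left fun p => ?_
      simp only [Triple.ρ, liftPath, rem0, delta1, Driver.inc, PiLp.sub_apply]
      ring
  have hcσ : ((liftPath (d := d) σ y).comp σ).IsControlled X κ := by
    refine ⟨m_σ, memC1_of_isBigO hκ hκγ.le fun ⟨m, j⟩ => ?_,
      memC1_of_isBigO hκ hκγ.le fun ⟨m, j, k⟩ => ?_,
      memC2_of_isBigO (k := 3) (γ := γ) (by linarith) (by push_cast; linarith) fun m => ?_,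
      memC2_of_isBigO (k := 2) (γ := γ) (by linarith) (by push_cast; linarith) fun ⟨m, j⟩ => ?_⟩
    · simp only [hY.comp_ζ1]
      exact (o_F _ (hσ.cof1 m j).mono).left
    · simp only [hY.comp_ζ2]
      exact (o_F _ (hσ.cof2 m j k)).left
    · simp only [hY.comp_r]
      exact (o_r0 m).left
    · simp only [hY.comp_ρ]
      exact (o_r1 m j).left
  refine ⟨⟨hcy, fun t ht => ⟨ha t ht, ?_⟩⟩, hcσ, ⟨eulerError X σ y, ⟨⟨4 * γ, by linarith,
    memC2_of_bound (by linarith) le_rfl hy⟩, ?_⟩, fun s t i => ?_⟩, fun t => rfl,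
    fun t i j k => ?_⟩
  · change σ (y t) = σ a
    rw [ha t ht]
  · funext s u t
    rw [hY.sewing_eq, delta2, eulerError_chen hX y s u t]
    change _ = defect σ (X.inc s u) (X.inc u t) (y s) (y u)
    abel
  · simp only [hY.comp_ζ1, hY.comp_ζ2]
    simp only [eulerError, euler, delta1, Driver.inc, PiLp.sub_apply, liftPath, Triple.comp]
    ring
  · rw [hY.comp_ζ1]
    rfl

end Existence

end RoughDiff

theorem theoremt2p1 (l d : ℕ) (T : ℝ) (hT : 0 < T) (γ κ : ℝ) (hγ : 1 / 4 < γ)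
    (hκ : 0 < κ) (hκγ : κ < γ) (hκγ' : 1 < 3 * κ + γ)
    (σ : RoughDiff.Vec (Fin l) → RoughDiff.Vec (Fin l × Fin d)) (hσ : RoughDiff.IsCb4 σ) :
    (∀ X : RoughDiff.Driver T d, X.IsRough γ → X.IsGeometric →
      ∀ a : RoughDiff.Vec (Fin l),
        ∃! Y : RoughDiff.Triple T d (Fin l), RoughDiff.IsSolution X κ σ a Y) ∧
    (∀ M : NNReal, ∃ c : NNReal, 0 < c ∧
      ∀ X X' : RoughDiff.Driver T d, X.IsRough γ → X.IsGeometric →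
        X'.IsRough γ → X'.IsGeometric → X.size γ ≤ M → X'.size γ ≤ M →
        ∀ (a a' : RoughDiff.Vec (Fin l)) (Y Y' : RoughDiff.Triple T d (Fin l)),
          RoughDiff.IsSolution X κ σ a Y → RoughDiff.IsSolution X' κ σ a' Y' →
          RoughDiff.norm1 κ (fun t => Y.z t - Y'.z t) ≤
            c * (‖a - a'‖ₑ + RoughDiff.norm1 γ (fun t => X.x t - X'.x t)
              + RoughDiff.norm2 (2 * γ) (fun s t => X.x2 s t - X'.x2 s t)
              + RoughDiff.norm2 (3 * γ) (fun s t => X.x3 s t - X'.x3 s t))) := by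
  refine ⟨fun X hX hg a => ?_, fun M => RoughDiff.exists_lipschitz hT hσ.isRegular hγ hκγ M⟩
  obtain ⟨y, K, ha, hy⟩ := RoughDiff.exists_path hσ.isRegular hγ hT hX hg hX.size_le a
  exact ⟨_, RoughDiff.liftPath_isSolution hσ.isRegular hγ hκ hκγ hX hg hX.size_le ha hy,
    fun Y' hY' => hY'.unique hT hσ.isRegular hγ hκγ hX hg
      (RoughDiff.liftPath_isSolution hσ.isRegular hγ hκ hκγ hX hg hX.size_le ha hy)⟩
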